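/- Let $\mathfrak K=(K,\le_{\mathfrak K})$ be an abstract elementary class (a.e.c.) in a vocabulary $\tau$. That is, $K$ is a class of $\tau$-structures and $\le_{\mathfrak K}$ is a relation on $K$; both are closed under isomorphism; $M\le_{\mathfrak K}N$ implies that $M$ is a submodel of $N$; $\le_{\mathfrak K}$ is reflexive on $K$ and transitive; if $\langle M_i:i<\kappa\rangle$ ($\kappa$ a regular cardinal) is $\le_{\mathfrak K}$-increasing and continuous, then $M_0\le_{\mathfrak K}\bigcup_{i<\kappa}M_i$, and if moreover $M_i\le_{\mathfrak K}N$ for all $i<\kappa$, then $\bigcup_{i<\kappa}M_i\le_{\mathfrak K}N$; if $N_0\subseteq N_1\le_{\mathfrak K}M$ and $N_0\le_{\mathfrak K}M$, then $N_0\le_{\mathfrak K}N_1$; and there is a least infinite cardinal $\mathrm{LS}(\mathfrak K)\ge|\tau|$ such that every $A\subseteq N\in K$ with $|A|\le\mathrm{LS}(\mathfrak K)$ is contained in some $M\le_{\mathfrak K}N$ of cardinality $\le\mathrm{LS}(\mathfrak K)$. For a cardinal $\mu$ let $K_\mu=\{M\in K:\|M\|=\mu\}$. An embedding $f:M\to N$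 is a $\le_{\mathfrak K}$-embedding if its range is (the universe of) a model $\le_{\mathfrak K}N$. A model $M\in K_\mu$ is universal in $K_\mu$ if every member of $K_\mu$ can be $\le_{\mathfrak K}$-embedded into $M$. Let $\dot I(\mu,K)$ be the number of members of $K_\mu$ up to isomorphism. Let $\lambda\ge\mathrm{LS}(\mathfrak K)$ be a cardinal. A set $S\subseteq\lambda^+$ is *not small* (does not belong to the weak diamond ideal $\mathrm{WDmId}_{\lambda^+}$) if for every $\mathbf c:{}^{\lambda^+>}(\lambda^+)\to\{0,1\}$ there is $\langle\ell_\delta:\delta<\lambda^+\rangle\in{}^{\lambda^+}2$ such that for every $\eta\in{}^{\lambda^+}(\lambda^+)$ the set $\{\delta\in S:\mathbf c(\eta\restriction\delta)=\ell_\delta\}$ is stationary in $\lambda^+$. For a stationary $S\subseteq\lambda^+$, a model $M\in K_\lambda$ is *$S$-weakly limit* if (i) $M$ is universal in $K_\lambda$; (ii) whenever $M\le_{\mathfrak K}M_1\in K_\lambda$, there is $N\in K_\lambda$ with $M_1\le_{\mathfrak K}N$ and $N\ne M_1$; (iii) there is a function $\mathbf F$ which assigns to every $\le_{\mathfrak K}$-increasing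 continuous sequence $\langle M_j:j\le i\rangle$, $i<\lambda^+$, of members of $K_\lambda$ a model $\mathbf F(\langle M_j:j\le i\rangle)\in K_\lambda$ with $M_i\le_{\mathfrak K}\mathbf F(\langle M_j:j\le i\rangle)$, such that: if $\langle M_i:i<\lambda^+\rangle$ is a $\le_{\mathfrak K}$-increasing continuous sequence of members of $K_\lambda$, $M_0\cong M$, and $M_{i+1}\le_{\mathfrak K}\mathbf F(\langle M_j:j\le i+1\rangle)\le_{\mathfrak K}M_{i+2}$ for all $i<\lambda^+$, then there is a closed unbounded $C\subseteq\lambda^+$ with $M_\delta\cong M$ for all $\delta\in S\cap C$. (In (iii) the models in the sequences and the values of $\mathbf F$ are restricted to models whose universe is an ordinal $<\lambda^+$; $\mathbf F$ need not be invariant under isomorphism.) A model $M\in K_\lambda$ has the *$\lambda$-amalgamation property* if for all $M_1,M_2\in K_\lambda$ with $M\le_{\mathfrak K}M_1$ and $M\le_{\mathfrak K}M_2$ there are $N\in K$ and $\le_{\mathfrak K}$-embeddings $f_1:M_1\to N$, $f_2:M_2\to N$ with $f_1\restriction M=f_2\restriction M$. **Theorem 3.5.** Assume that $2^\lambda<2^{\lambda^+}$,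 that $S\subseteq\lambda^+$ is not small, that $M\in K_\lambda$ is $S$-weakly limit, and that $M$ does not have the $\lambda$-amalgamation property. Then 1. $\dot I(\lambda^+,K)=2^{\lambda^+}$; 2. there is no universal member in $K_{\lambda^+}$; 3. if moreover $(2^\lambda)^+<2^{\lambda^+}$, then there are $2^{\lambda^+}$ models in $K_{\lambda^+}$, none of which is $\le_{\mathfrak K}$-embeddable into another. -/

import Mathlib

open Cardinal
open scoped FirstOrder

universe u

/-- An abstract elementary class `(K, ≤_K)` in the vocabulary `L`.  `Mem M` says `M ∈ K`;
`Strong N S` says that the submodel `S` of `N` satisfies `S ≤_K N`.  A relation `S ≤_K T`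
between two submodels `S`, `T` of one structure is expressed as `S ≤ T` together with
`Strong T (S.comap T.subtype.toHom)`, where `S.comap T.subtype.toHom` is `S` seen inside `T`.
An increasing chain is a chain of submodels of one `L`-structure. -/
structure AEC (L : FirstOrder.Language.{u, u}) where
  /-- Membership in the class `K`. -/
  Mem : (M : Type u) → [L.Structure M] → Prop
  /-- The relation `S ≤_K N`, for `S` a submodel of `N`. -/
  Strong : (N : Type u) → [L.Structure N] → L.Substructure N → Prop
  /-- `≤_K` is a relation between members of `K`. -/
  mem_of_strong : ∀ {N : Type u} [L.Structure N] {S : L.Substructure N},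
    Strong N S → Mem N ∧ Mem S
  /-- `K` is closed under isomorphism. -/
  mem_iso : ∀ {M N : Type u} [L.Structure M] [L.Structure N], (M ≃[L] N) → Mem M → Mem N
  /-- `≤_K` is invariant under isomorphism. -/
  strong_iso : ∀ {M N : Type u} [L.Structure M] [L.Structure N] (e : M ≃[L] N)
    {S : L.Substructure M}, Strong M S → Strong N (S.map e.toHom)
  /-- `≤_K` is reflexive on `K`. -/
  refl : ∀ {M : Type u} [L.Structure M], Mem M → Strong M ⊤
  /-- `≤_K` is transitive. -/
  trans : ∀ {N : Type u} [L.Structure N] {S T : L.Substructure N}, S ≤ T →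
    Strong T (S.comap T.subtype.toHom) → Strong N T → Strong N S
  /-- The first member of an increasing continuous chain of regular length is `≤_K` the union
  of the chain. -/
  chain : ∀ (κ : Cardinal.{u}), κ.IsRegular → ∀ {N : Type u} [L.Structure N]
    (M : Ordinal.{u} → L.Substructure N),
    (∀ i j, i < j → j < κ.ord → M i ≤ M j ∧ Strong (M j) ((M i).comap (M j).subtype.toHom)) →
    (∀ δ, δ < κ.ord → Order.IsSuccLimit δ → ∀ x ∈ M δ, ∃ i < δ, x ∈ M i) →
    (∀ x : N, ∃ i < κ.ord, x ∈ M i) →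
    Strong N (M 0)
  /-- The union `T` of an increasing continuous chain of regular length of models `≤_K N`
  satisfies `T ≤_K N`. -/
  chain_le : ∀ (κ : Cardinal.{u}), κ.IsRegular → ∀ {N : Type u} [L.Structure N]
    (M : Ordinal.{u} → L.Substructure N),
    (∀ i j, i < j → j < κ.ord → M i ≤ M j ∧ Strong (M j) ((M i).comap (M j).subtype.toHom)) →
    (∀ δ, δ < κ.ord → Order.IsSuccLimit δ → ∀ x ∈ M δ, ∃ i < δ, x ∈ M i) →
    (∀ i < κ.ord, Strong N (M i)) →
    ∀ T : L.Substructure N, (∀ x, x ∈ T ↔ ∃ i < κ.ord, x ∈ M i) → Strong N T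
  /-- Coherence: if `S ⊆ T ≤_K N` and `S ≤_K N` then `S ≤_K T`. -/
  coherence : ∀ {N : Type u} [L.Structure N] {S T : L.Substructure N}, S ≤ T →
    Strong N S → Strong N T → Strong T (S.comap T.subtype.toHom)
  /-- Some infinite cardinal `κ ≥ |L|` has the Löwenheim-Skolem property. -/
  exists_LS : ∃ κ : Cardinal.{u}, ℵ₀ ≤ κ ∧ L.card ≤ κ ∧
    ∀ (N : Type u) [L.Structure N], Mem N → ∀ A : Set N, #A ≤ κ →
      ∃ S : L.Substructure N, Strong N S ∧ A ⊆ S ∧ #S ≤ κ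

/-- A model whose universe is an ordinal `< λ⁺`: the universe is a proper initial segment of
the well-order `λ⁺`. -/
structure OrdModel (L : FirstOrder.Language.{u, u}) (lam : Cardinal.{u}) where
  /-- The ordinal that is the universe. -/
  bound : (Order.succ lam).ord.ToType
  /-- The interpretation of the vocabulary. -/
  str : L.Structure (Set.Iio bound)

/-- The universe of an `OrdModel`. -/
abbrev OrdModel.Carrier {L : FirstOrder.Language.{u, u}} {lam : Cardinal.{u}} (A : OrdModel L lam) :
    Type u :=
  Set.Iio A.bound

instance OrdModel.instStructure {L : FirstOrder.Language.{u, u}} {lam : Cardinal.{u}}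
    (A : OrdModel L lam) : L.Structure A.Carrier :=
  A.str

namespace AEC

variable {L : FirstOrder.Language.{u, u}} (K : AEC L)

/-- The Löwenheim-Skolem number: the least infinite cardinal `κ ≥ |L|` such that every subset of
size `≤ κ` of a model `N ∈ K` is contained in some `S ≤_K N` of size `≤ κ`. -/
noncomputable def LS : Cardinal.{u} :=
  sInf {κ : Cardinal.{u} | ℵ₀ ≤ κ ∧ L.card ≤ κ ∧
    ∀ (N : Type u) [L.Structure N], K.Mem N → ∀ A : Set N, #A ≤ κ →
      ∃ S : L.Substructure N, K.Strong N S ∧ A ⊆ S ∧ #S ≤ κ}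

/-- `M ∈ K_μ`: `M` is a member of `K` of cardinality `μ`. -/
def MemCard (μ : Cardinal.{u}) (M : Type u) [L.Structure M] : Prop :=
  K.Mem M ∧ #M = μ

/-- `f` is a `≤_K`-embedding: its range is `≤_K` the target. -/
def IsStrongEmb {M N : Type u} [L.Structure M] [L.Structure N] (f : M ↪[L] N) : Prop :=
  K.Strong N f.toHom.range

/-- `M` is `≤_K`-embeddable into `N`. -/
def Embeds (M N : Type u) [L.Structure M] [L.Structure N] : Prop :=
  ∃ f : M ↪[L] N, K.IsStrongEmb f

/-- `M` is universal in `K_μ`: it belongs to `K_μ` and every member of `K_μ` is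
`≤_K`-embeddable into it. -/
def IsUniversal (μ : Cardinal.{u}) (M : Type u) [L.Structure M] : Prop :=
  K.MemCard μ M ∧ ∀ (N : Type u) [L.Structure N], K.MemCard μ N → K.Embeds N M

/-- The model `M` has the `(μ, ν)`-amalgamation property: any two `≤_K`-extensions of `M` of
cardinalities `μ` and `ν` can be `≤_K`-embedded over `M` into one model. -/
def HasAP (μ ν : Cardinal.{u}) (M : Type u) [L.Structure M] : Prop :=
  ∀ (M₁ M₂ : Type u) [L.Structure M₁] [L.Structure M₂],
    K.MemCard μ M₁ → K.MemCard ν M₂ →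
    ∀ (g₁ : M ↪[L] M₁) (g₂ : M ↪[L] M₂), K.IsStrongEmb g₁ → K.IsStrongEmb g₂ →
      ∃ (N : Type u) (_ : L.Structure N) (f₁ : M₁ ↪[L] N) (f₂ : M₂ ↪[L] N),
        K.IsStrongEmb f₁ ∧ K.IsStrongEmb f₂ ∧ ∀ x, f₁ (g₁ x) = f₂ (g₂ x)

/-- The set of isomorphism types of members of `K_μ`; its cardinality is `I(μ, K)`. -/
def isoTypes (μ : Cardinal.{u}) :
    Set (Quotient (FirstOrder.Language.equivSetoid : Setoid (CategoryTheory.Bundled.{u} L.Structure))) :=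
  {q | ∃ M : CategoryTheory.Bundled.{u} L.Structure, K.MemCard μ M ∧ q = ⟦M⟧}

variable {lam : Cardinal.{u}}

/-- `A ≤_K B` for models with universes ordinals `< λ⁺`: the inclusion map is a
`≤_K`-embedding. -/
def OrdLE (A B : OrdModel L lam) : Prop :=
  ∃ f : A.Carrier ↪[L] B.Carrier,
    (∀ x, ((f x : B.Carrier) : (Order.succ lam).ord.ToType) = x) ∧ K.IsStrongEmb f

/-- `⟨A i : i ∈ I⟩` is a `≤_K`-increasing continuous sequence of members of `K_λ`, with
universes ordinals `< λ⁺`. -/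
def IncCont {I : Type u} [LinearOrder I] (A : I → OrdModel L lam) : Prop :=
  (∀ i, K.MemCard lam (A i).Carrier) ∧
  (∀ i j, i < j → K.OrdLE (A i) (A j)) ∧
  (∀ δ, Order.IsSuccLimit δ → ∀ x < (A δ).bound, ∃ i < δ, x < (A i).bound)

/-- `M` is `S`-weakly limit, `S` being a stationary subset of `λ⁺`.  The function `F` acts on
the `≤_K`-increasing continuous sequences `⟨A j : j ≤ i⟩`, `i < λ⁺`, of members of `K_λ` whose
universes are ordinals `< λ⁺`; no invariance of `F` under isomorphism is required. -/
def IsWeaklyLimit (lam : Cardinal.{u}) (S : Set (Order.succ lam).ord.ToType)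
    (M : Type u) [L.Structure M] : Prop :=
  IsStationary S ∧
  K.IsUniversal lam M ∧
  (∀ (M₁ : Type u) [L.Structure M₁], K.MemCard lam M₁ → K.Embeds M M₁ →
    ∃ (N : Type u) (_ : L.Structure N) (f : M₁ ↪[L] N),
      K.MemCard lam N ∧ K.IsStrongEmb f ∧ ¬ Function.Surjective f) ∧
  ∃ F : (i : (Order.succ lam).ord.ToType) → (Set.Iic i → OrdModel L lam) → OrdModel L lam,
    (∀ (i : (Order.succ lam).ord.ToType) (A : Set.Iic i → OrdModel L lam), K.IncCont A →
      K.MemCard lam (F i A).Carrier ∧ K.OrdLE (A ⟨i, Set.self_mem_Iic⟩) (F i A)) ∧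
    (∀ A : (Order.succ lam).ord.ToType → OrdModel L lam, K.IncCont A →
      (∀ i, IsMin i → Nonempty ((A i).Carrier ≃[L] M)) →
      (∀ i, K.OrdLE (A (Order.succ i)) (F (Order.succ i) fun j => A j) ∧
        K.OrdLE (F (Order.succ i) fun j => A j) (A (Order.succ (Order.succ i)))) →
      ∃ C : Set (Order.succ lam).ord.ToType, IsClub C ∧
        ∀ δ ∈ S ∩ C, Nonempty ((A δ).Carrier ≃[L] M))

end AEC

/-- The weak diamond ideal on `λ⁺`: its members are the small sets.  A set `S ⊆ λ⁺` is *not*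
small if for every colouring `c` of the sequences of length `< λ⁺` of elements of `λ⁺` with two
colours there is `ℓ : λ⁺ → 2` such that for every `η : λ⁺ → λ⁺` the set of the `δ ∈ S` with
`c (η ↾ δ) = ℓ δ` is stationary. -/
def WDmId (lam : Cardinal.{u}) : Set (Set (Order.succ lam).ord.ToType) :=
  {S | ¬ ∀ c : (δ : (Order.succ lam).ord.ToType) →
        (Set.Iio δ → (Order.succ lam).ord.ToType) → Bool,
      ∃ l : (Order.succ lam).ord.ToType → Bool,
        ∀ η : (Order.succ lam).ord.ToType → (Order.succ lam).ord.ToType,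
          IsStationary {δ | δ ∈ S ∧ c δ (fun x => η x) = l δ}}

/-! Fix extensions `M₁`, `M₂` of `M` that cannot be amalgamated over `M`. Models of size λ are
arranged in a tree rooted at a copy of `M`, whose branches are functions `η` on λ⁺. The function `F`
of a weakly limit model constrains only what follows a successor stage. So at a limit stage `δ`
whose model is a copy of `M`, the value `η δ` is free to decide which extension of `M` the branch
goes through. Being `S`-weakly limit provides such stages on a club relative to `S`, and the union
`N η` of the branch has size λ⁺ (`exists_weaklyLimit_tree`, `WeaklyLimitTree`).

No universal model. Let all `N η` embed into `P` of size λ⁺. The weak diamond (`exists_guess`)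
guesses at each `δ` whether the restriction to `δ` of a branch and its embedding into `P` extends to
such a pair going through `M₁` at `δ`. Take the branch that chooses `M₂` when the guess is yes and
`M₁` when it is no. Where the guess is right, "no" is refuted by the branch itself, and "yes" gives
embeddings of `M₁` and `M₂` into `P` that agree on the copy of `M`, a contradiction
(`exists_amalgam_of_universal`).

Many models. There are two cases.

(a) Some extension `X` of `M` is such that any two extensions of `X` amalgamate over `M`. Split `S`
into λ⁺ disjoint sets that are not small (`exists_disjoint_not_mem_WDmId`). For an index set `Y ⊆
λ⁺`, the branch follows the guesses on the pieces in `Y` and goes through `X` elsewhere. If one such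
model embeds into another although a piece is used only by the first, the same guessing puts `M₁`
and `M₂` beside copies of `X` in two models of size λ, and amalgamating these over `M` amalgamates
`M₁` with `M₂` (`exists_family`). An antichain of index sets gives 2^(λ⁺) pairwise non-embeddable
models.

(b) Every extension of `M` has two extensions that cannot be amalgamated over `M`. A binary tree
then gives 2^(λ⁺) models, no two of which embed over `M` into one model
(`exists_pairwise_not_amalgamable`). An embedding into a fixed model of size λ⁺ is determined, as
far as the index is concerned, by its restriction to `M`, so at most (λ⁺)^λ ≤ 2^λ of the models
embed into it. Counting gives 2^(λ⁺) isomorphism types, and Hajnal's free set theorem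
(`exists_isFreeFor`) gives 2^(λ⁺) pairwise non-embeddable ones when (2^λ)⁺ < 2^(λ⁺). -/

/-! ### Continuous cofinal sequences in well-orders -/

section CofinalChain

open Order

/-- Every well-order without maximum has a continuous weakly increasing cofinal sequence of regular
length, starting at a given point. -/
theorem exists_continuous_cofinal_sequence {I : Type u} [LinearOrder I] [WellFoundedLT I]
    [NoMaxOrder I] (i₀ : I) :
    ∃ κ : Cardinal.{u}, κ.IsRegular ∧ ∃ s : Ordinal.{u} → I, s 0 = i₀ ∧
      (∀ a b, a ≤ b → b < κ.ord → s a ≤ s b) ∧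
      (∀ δ, δ < κ.ord → IsSuccLimit δ → ∀ j < s δ, ∃ a < δ, j < s a) ∧
      ∀ j, ∃ a < κ.ord, j ≤ s a := by
  have : Nonempty I := ⟨i₀⟩
  obtain ⟨C, hC, hCκ⟩ := Order.exists_cof_eq (α := I)
  set κ := Order.cof I with hκ
  have hreg : κ.IsRegular := ⟨Order.aleph0_le_cof, (Order.cof_ord_cof I).ge⟩
  have hcard : #κ.ord.ToType = #C := by rw [hCκ]; simp
  obtain ⟨e⟩ := Cardinal.eq.1 hcard
  let t : κ.ord.ToType → Ordinal.{u} := fun k => (Ordinal.ToType.mk.symm k : Set.Iio κ.ord)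
  -- `s a` will be the least point above `i₀` and above the elements of `C` enumerated before `a`.
  -- Leastness gives continuity; `B a` is nonempty since fewer than `κ` points are not cofinal.
  let B : Ordinal.{u} → Set I := fun a => {x | i₀ ≤ x ∧ ∀ k, t k < a → (e k : I) ≤ x}
  have hB : ∀ a < κ.ord, (B a).Nonempty := by
    intro a ha
    let D : Set I := (fun k => (e k : I)) '' Set.Iio (Ordinal.ToType.mk ⟨a, ha⟩)
    have hD : ¬ IsCofinal D := by
      intro h
      have h1 := Order.cof_le h
      have h2 : #D < κ := by
        refine mk_image_le.trans_lt ?_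
        have := mk_Iio_lt (α := κ.ord.ToType) (Ordinal.ToType.mk ⟨a, ha⟩) (by simp)
        simpa using this
      exact absurd (h1.trans_lt h2) (lt_irrefl _)
    rw [IsCofinal] at hD
    push Not at hD
    obtain ⟨x, hx⟩ := hD
    refine ⟨max i₀ x, le_max_left _ _, fun k hk => ?_⟩
    refine le_max_of_le_right (hx _ ⟨k, ?_, rfl⟩).le
    rw [Set.mem_Iio, ← Ordinal.ToType.mk.symm.lt_iff_lt, OrderIso.symm_apply_apply]
    exact hk
  classical
  let s : Ordinal.{u} → I := fun a =>
    if h : (B a).Nonempty then WellFounded.min (wellFounded_lt (α := I)) (B a) h else i₀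
  have hs : ∀ a < κ.ord, s a ∈ B a ∧ ∀ x ∈ B a, s a ≤ x := by
    intro a ha
    simp only [s, dif_pos (hB a ha)]
    exact ⟨WellFounded.min_mem _ _ _, fun x hx => not_lt.1 (WellFounded.not_lt_min _ _ hx)⟩
  have ht : ∀ a, a < κ.ord → ∃ k, t k = a := fun a ha =>
    ⟨Ordinal.ToType.mk ⟨a, ha⟩, by simp [t]⟩
  have hmono : ∀ a b, a ≤ b → b < κ.ord → s a ≤ s b := fun a b hab hb =>
    (hs a (hab.trans_lt hb)).2 _ ⟨(hs b hb).1.1, fun k hk => (hs b hb).1.2 k (hk.trans_le hab)⟩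
  have hlim : IsSuccLimit κ.ord := isSuccLimit_ord hreg.aleph0_le
  refine ⟨κ, hreg, s, ?_, hmono, ?_, ?_⟩
  · refine le_antisymm ((hs 0 hreg.ord_pos).2 _ ⟨le_rfl, fun k hk => ?_⟩) (hs 0 hreg.ord_pos).1.1
    exact absurd hk (not_lt.2 (zero_le))
  · intro δ hδ hl j hj
    have hjB : j ∉ B δ := fun h => absurd ((hs δ hδ).2 j h) (not_le.2 hj)
    have h0 : (0 : Ordinal) < δ := hl.bot_lt
    by_cases hij : i₀ ≤ j
    · have : ∃ k, t k < δ ∧ j < e k := by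
        by_contra hcon
        push Not at hcon
        exact hjB ⟨hij, fun k hk => hcon k hk⟩
      obtain ⟨k, hk, hjk⟩ := this
      have h1 : Order.succ (t k) < δ := hl.succ_lt hk
      exact ⟨_, h1, hjk.trans_le ((hs _ (h1.trans hδ)).1.2 k (Order.lt_succ _))⟩
    · exact ⟨0, h0, (not_le.1 hij).trans_le (hs 0 hreg.ord_pos).1.1⟩
  · intro j
    obtain ⟨c, hc, hjc⟩ := hC j
    have h1 : Order.succ (t (e.symm ⟨c, hc⟩)) < κ.ord :=
      hlim.succ_lt (Ordinal.ToType.mk.symm (e.symm ⟨c, hc⟩) : Set.Iio κ.ord).2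
    refine ⟨_, h1, hjc.trans ?_⟩
    have := (hs _ h1).1.2 (e.symm ⟨c, hc⟩) (Order.lt_succ _)
    simpa using this

end CofinalChain

/-! ### Strong embeddings, and chains of arbitrary well-ordered length -/

namespace AEC

open FirstOrder FirstOrder.Language

variable {L : FirstOrder.Language.{u, u}} {K : AEC L}
  {M N P : Type u} [L.Structure M] [L.Structure N] [L.Structure P]

theorem IsStrongEmb.mem_right {f : M ↪[L] N} (h : K.IsStrongEmb f) : K.Mem N :=
  (K.mem_of_strong h).1

theorem isStrongEmb_of_surjective {f : M ↪[L] N} (hN : K.Mem N) (hf : Function.Surjective f) :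
    K.IsStrongEmb f := by
  have : f.toHom.range = ⊤ := Hom.range_eq_top.2 hf
  rw [IsStrongEmb, this]
  exact K.refl hN

theorem isStrongEmb_equiv (e : M ≃[L] N) (hN : K.Mem N) : K.IsStrongEmb e.toEmbedding :=
  isStrongEmb_of_surjective hN e.surjective

theorem comap_range_comp (f : M ↪[L] N) (g : N ↪[L] P) :
    (g.comp f).toHom.range.comap g.toHom.range.subtype.toHom
      = f.toHom.range.map g.equivRange.toHom := by
  ext ⟨x, hx⟩
  simp only [Substructure.mem_comap, Hom.mem_range, Substructure.mem_map]
  constructor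
  · rintro ⟨y, hy⟩
    exact ⟨f y, ⟨y, rfl⟩, Subtype.ext hy⟩
  · rintro ⟨_, ⟨y, rfl⟩, hy⟩
    exact ⟨y, congrArg Subtype.val hy⟩

theorem range_comp_le (f : M ↪[L] N) (g : N ↪[L] P) :
    (g.comp f).toHom.range ≤ g.toHom.range := by
  rintro _ ⟨y, rfl⟩
  exact ⟨f y, rfl⟩

theorem IsStrongEmb.comp {f : M ↪[L] N} {g : N ↪[L] P} (hg : K.IsStrongEmb g)
    (hf : K.IsStrongEmb f) : K.IsStrongEmb (g.comp f) := by
  refine K.trans (range_comp_le f g) ?_ hg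
  rw [comap_range_comp]
  exact K.strong_iso _ hf

/-- This is the coherence axiom, transported along the isomorphism of `N` with its image in `P`. -/
theorem IsStrongEmb.of_comp {f : M ↪[L] N} {g : N ↪[L] P} (hg : K.IsStrongEmb g)
    (hgf : K.IsStrongEmb (g.comp f)) : K.IsStrongEmb f := by
  have h := K.coherence (range_comp_le f g) hgf hg
  rw [comap_range_comp] at h
  have h2 := K.strong_iso g.equivRange.symm h
  have h3 : f.toHom.range =
      (f.toHom.range.map g.equivRange.toHom).map g.equivRange.symm.toHom := ?_
  · rw [IsStrongEmb, h3]
    exact h2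
  ext x
  simp only [Substructure.mem_map]
  constructor
  · intro hx
    exact ⟨_, ⟨x, hx, rfl⟩, g.equivRange.symm_apply_apply x⟩
  · rintro ⟨_, ⟨y, hy, rfl⟩, rfl⟩
    rwa [show g.equivRange.symm.toHom (g.equivRange.toHom y) = y from
      g.equivRange.symm_apply_apply y]

theorem Embeds.trans (h₁ : K.Embeds M N) (h₂ : K.Embeds N P) : K.Embeds M P := by
  obtain ⟨f, hf⟩ := h₁
  obtain ⟨g, hg⟩ := h₂
  exact ⟨g.comp f, hg.comp hf⟩

theorem Embeds.of_equiv (e : M ≃[L] N) (hN : K.Mem N) : K.Embeds M N :=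
  ⟨_, isStrongEmb_equiv e hN⟩

/-- The members of a continuous increasing chain indexed by any well-order without maximum are
strong submodels of the union of the chain. -/
theorem strong_of_chain {I : Type u} [LinearOrder I] [WellFoundedLT I] [NoMaxOrder I]
    (T : I → L.Substructure N) (hmem : ∀ i, K.Mem (T i))
    (hT : ∀ i j, i < j → T i ≤ T j ∧ K.Strong (T j) ((T i).comap (T j).subtype.toHom))
    (hcont : ∀ δ, Order.IsSuccLimit δ → ∀ x ∈ T δ, ∃ i < δ, x ∈ T i)
    (hcover : ∀ x : N, ∃ i, x ∈ T i) (i₀ : I) : K.Strong N (T i₀) := by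
  -- The chain axiom speaks only of regular lengths, so the chain is thinned to a continuous cofinal
  -- subsequence that starts at `i₀`.
  obtain ⟨κ, hκ, s, hs0, hmono, hlim, hcof⟩ := exists_continuous_cofinal_sequence i₀
  have hle : ∀ i j, i ≤ j → T i ≤ T j := fun i j hij => by
    rcases hij.eq_or_lt with rfl | h
    · exact le_rfl
    · exact (hT i j h).1
  rw [← hs0]
  refine K.chain κ hκ (fun a => T (s a)) ?_ ?_ ?_
  · intro a b hab hb
    rcases (hmono a b hab.le hb).eq_or_lt with h | h
    · simp only [h]
      refine ⟨le_rfl, ?_⟩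
      have : (T (s b)).comap (T (s b)).subtype.toHom = ⊤ := by
        ext x
        simp
      rw [this]
      exact K.refl (hmem _)
    · exact hT _ _ h
  · intro δ hδ hl x hx
    by_cases hδl : Order.IsSuccLimit (s δ)
    · obtain ⟨j, hj, hxj⟩ := hcont _ hδl x hx
      obtain ⟨a, ha, hja⟩ := hlim δ hδ hl j hj
      exact ⟨a, ha, hle _ _ hja.le hxj⟩
    -- As `s` is only weakly increasing, `s δ` may be minimal or a successor; then continuity forces
    -- `s` to reach it before `δ`.
    · have : ∃ a < δ, s δ ≤ s a := by
        rw [Order.not_isSuccLimit_iff] at hδl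
        rcases hδl with hmin | hpre
        · exact ⟨0, hl.bot_lt, (hmin.isBot _ : s δ ≤ s 0)⟩
        · rw [Order.not_isSuccPrelimit_iff] at hpre
          obtain ⟨j, hj⟩ := hpre
          obtain ⟨a, ha, hja⟩ := hlim δ hδ hl j hj.lt
          exact ⟨a, ha, hj.ge_of_gt hja⟩
      obtain ⟨a, ha, h⟩ := this
      exact ⟨a, ha, hle _ _ h hx⟩
  · intro x
    obtain ⟨i, hi⟩ := hcover x
    obtain ⟨a, ha, hia⟩ := hcof i
    exact ⟨a, ha, hle _ _ hia hi⟩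

end AEC

/-! ### Regularity and initial segments of λ⁺ -/

/-- The well-order `λ⁺`. -/
abbrev SuccOrd (lam : Cardinal.{u}) : Type u := (Order.succ lam).ord.ToType

namespace SuccOrd

open Order

variable {lam : Cardinal.{u}}

theorem mk_eq : #(SuccOrd lam) = succ lam := by simp

theorem mk_Iio_le (b : SuccOrd lam) : #(Set.Iio b) ≤ lam := by
  have := mk_Iio_lt (α := SuccOrd lam) b (by simp)
  rw [mk_eq] at this
  exact Order.lt_succ_iff.1 this

theorem isRegular_succ (h : ℵ₀ ≤ lam) : (succ lam).IsRegular := Cardinal.isRegular_succ h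

theorem cof_eq (h : ℵ₀ ≤ lam) : Order.cof (SuccOrd lam) = succ lam := by
  rw [Ordinal.cof_toType, (isRegular_succ h).cof_ord]

theorem cof_ne_aleph0 (h : ℵ₀ ≤ lam) : Order.cof (SuccOrd lam) ≠ ℵ₀ := by
  rw [cof_eq h]
  exact (h.trans_lt (Order.lt_succ lam)).ne'

theorem exists_gt_of_card_le (h : ℵ₀ ≤ lam) (C : Set (SuccOrd lam)) (hC : #C ≤ lam) :
    ∃ b, ∀ x ∈ C, x < b := by
  by_contra hcon
  push Not at hcon
  have h1 := Order.cof_le (s := C) (fun b => hcon b)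
  rw [cof_eq h] at h1
  exact absurd (h1.trans hC) (not_le.2 (Order.lt_succ lam))

theorem exists_gt_of_range {ι : Type u} (h : ℵ₀ ≤ lam) (hι : #ι ≤ lam) (f : ι → SuccOrd lam) :
    ∃ b, ∀ i, f i < b := by
  obtain ⟨b, hb⟩ := exists_gt_of_card_le h (Set.range f) (mk_range_le.trans hι)
  exact ⟨b, fun i => hb _ ⟨i, rfl⟩⟩

theorem noMaxOrder (h : ℵ₀ ≤ lam) : NoMaxOrder (SuccOrd lam) :=
  ⟨fun a => by
    obtain ⟨b, hb⟩ := exists_gt_of_card_le h {a}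
      (by rw [mk_singleton]; exact one_le_aleph0.trans h)
    exact ⟨b, hb a rfl⟩⟩

theorem nonempty (h : ℵ₀ ≤ lam) : Nonempty (SuccOrd lam) := by
  rw [← mk_ne_zero_iff, mk_eq]
  exact (isRegular_succ h).ne_zero

/-- Take `b = a + κ.ord`, which stays below λ⁺ because λ⁺ is additively principal. The interval
makes room for the new elements when an extension of an `OrdModel` is copied onto an ordinal. -/
theorem exists_mk_Ico_eq (h : ℵ₀ ≤ lam) (a : SuccOrd lam) (κ : Cardinal.{u}) (hκ : κ ≤ lam) :
    ∃ b, a ≤ b ∧ #(Set.Ico a b) = κ := by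
  let t : SuccOrd lam ≃o Set.Iio (succ lam).ord := Ordinal.ToType.mk.symm
  have hprin := Ordinal.isPrincipal_add_ord (isRegular_succ h).aleph0_le
  have hlt : (t a : Ordinal.{u}) + κ.ord < (succ lam).ord :=
    hprin (t a).2 (ord_lt_ord.2 (hκ.trans_lt (Order.lt_succ _)))
  refine ⟨t.symm ⟨_, hlt⟩, ?_, ?_⟩
  · rw [← t.le_iff_le, OrderIso.apply_symm_apply, ← Subtype.coe_le_coe]
    exact le_self_add
  · have key : ∀ x : SuccOrd lam, x ∈ Set.Ico a (t.symm ⟨_, hlt⟩) ↔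
        ((t a : Ordinal.{u}) ≤ t x ∧ (t x : Ordinal.{u}) < (t a : Ordinal.{u}) + κ.ord) := by
      intro x
      rw [Set.mem_Ico]
      refine and_congr ?_ ?_
      · rw [← t.le_iff_le, ← Subtype.coe_le_coe]
      · rw [← t.lt_iff_lt, OrderIso.apply_symm_apply, ← Subtype.coe_lt_coe]
    have e : Set.Ico a (t.symm ⟨_, hlt⟩) ≃ Set.Iio κ.ord :=
      { toFun := fun x => ⟨(t x.1 : Ordinal.{u}) - t a, by
          have := (key x.1).1 x.2
          rw [Set.mem_Iio, Ordinal.sub_lt_of_le this.1]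
          exact this.2⟩
        invFun := fun o => ⟨t.symm ⟨(t a : Ordinal.{u}) + o.1,
            (add_lt_add_right o.2 _ : (t a : Ordinal.{u}) + o.1 < t a + κ.ord).trans hlt⟩, by
          rw [key, OrderIso.apply_symm_apply]
          exact ⟨le_self_add, add_lt_add_right o.2 _⟩⟩
        left_inv := fun x => by
          have := (key x.1).1 x.2
          apply Subtype.ext
          apply t.injective
          apply Subtype.ext
          simp only [OrderIso.apply_symm_apply]
          exact Ordinal.add_sub_cancel_of_le this.1
        right_inv := fun o => by
          apply Subtype.ext
          simp only [OrderIso.apply_symm_apply]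
          exact Ordinal.add_sub_cancel _ _ }
    have := Cardinal.mk_congr_lift e
    rw [Cardinal.mk_Iio_ordinal, card_ord, lift_lift] at this
    exact lift_injective.{u + 1, u} (by simpa using this)

end SuccOrd

/-! ### Models on ordinals, their extensions and unions -/

namespace AEC

open FirstOrder FirstOrder.Language

variable {L : FirstOrder.Language.{u, u}} {K : AEC L} {lam : Cardinal.{u}}

theorem OrdLE.refl {A : OrdModel L lam} (hA : K.Mem A.Carrier) : K.OrdLE A A :=
  ⟨Embedding.refl L _, fun _ => rfl,
    isStrongEmb_of_surjective hA (fun x => ⟨x, rfl⟩)⟩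

theorem OrdLE.trans {A B C : OrdModel L lam} (h₁ : K.OrdLE A B) (h₂ : K.OrdLE B C) :
    K.OrdLE A C := by
  obtain ⟨f, hf, hfs⟩ := h₁
  obtain ⟨g, hg, hgs⟩ := h₂
  exact ⟨g.comp f, fun x => (hg _).trans (hf x), hgs.comp hfs⟩

theorem OrdLE.embeds {A B : OrdModel L lam} (h : K.OrdLE A B) :
    K.Embeds A.Carrier B.Carrier := by
  obtain ⟨f, hf, hfs⟩ := h
  exact ⟨f, hfs⟩

theorem OrdLE.lt_bound {A B : OrdModel L lam} (h : K.OrdLE A B) {x : SuccOrd lam}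
    (hx : x < A.bound) : x < B.bound := by
  obtain ⟨f, hf, hfs⟩ := h
  have := (f ⟨x, hx⟩).2
  rw [hf] at this
  exact this

theorem OrdLE.bound_le {A B : OrdModel L lam} (h : K.OrdLE A B) : A.bound ≤ B.bound :=
  le_of_not_gt fun hlt => lt_irrefl _ (h.lt_bound hlt)

/-- A model whose universe is in bijection with an ordinal `< λ⁺` is isomorphic to an
`OrdModel`. -/
theorem exists_ordModel_equiv {N : Type u} [L.Structure N] {b : SuccOrd lam} (e : N ≃ Set.Iio b) :
    ∃ (B : OrdModel L lam) (E : N ≃[L] B.Carrier),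
      ∀ y, ((E y : B.Carrier) : SuccOrd lam) = e y :=
  ⟨⟨b, Equiv.inducedStructure e⟩, @Equiv.inducedStructureEquiv L N (Set.Iio b) _ e, fun _ => rfl⟩

/-- A strong extension of an `OrdModel` is isomorphic over it to an `OrdModel`. -/
theorem exists_ordModel_extension (hlam : ℵ₀ ≤ lam) {A : OrdModel L lam} {N : Type u}
    [L.Structure N] (hN : K.MemCard lam N) (g : A.Carrier ↪[L] N) (hg : K.IsStrongEmb g) :
    ∃ (B : OrdModel L lam) (e : N ≃[L] B.Carrier),
      (∀ x, ((e (g x) : B.Carrier) : SuccOrd lam) = x) ∧ K.MemCard lam B.Carrier ∧ K.OrdLE A B := by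
  classical
  obtain ⟨b, hab, hb⟩ := SuccOrd.exists_mk_Ico_eq hlam A.bound #((Set.range g)ᶜ : Set N)
    ((mk_set_le _).trans hN.2.le)
  obtain ⟨e₂⟩ := Cardinal.eq.1 hb
  let e₁ : A.Carrier ≃ Set.range g := Equiv.ofInjective g g.injective
  let e : Set.Iio b ≃ N :=
    { toFun := fun x => if h : x.1 < A.bound then e₁ ⟨x.1, h⟩ else e₂ ⟨x.1, not_lt.1 h, x.2⟩
      invFun := fun y => if h : y ∈ Set.range g then
          ⟨(e₁.symm ⟨y, h⟩).1, (e₁.symm ⟨y, h⟩).2.trans_le hab⟩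
        else ⟨(e₂.symm ⟨y, h⟩).1, (e₂.symm ⟨y, h⟩).2.2⟩
      left_inv := fun x => by
        by_cases h : x.1 < A.bound
        · have : ((e₁ ⟨x.1, h⟩ : Set.range g) : N) ∈ Set.range g := Subtype.prop _
          simp [h]
        · have : ((e₂ ⟨x.1, not_lt.1 h, x.2⟩ : ((Set.range g)ᶜ : Set N)) : N) ∉ Set.range g :=
            (e₂ ⟨x.1, not_lt.1 h, x.2⟩).2
          simp only [dif_neg h, dif_neg this, Subtype.coe_eta, Equiv.symm_apply_apply]
      right_inv := fun y => by
        by_cases h : y ∈ Set.range g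
        · have h2 : (e₁.symm ⟨y, h⟩ : SuccOrd lam) < A.bound := (e₁.symm ⟨y, h⟩).2
          simp only [dif_pos h, dif_pos h2, Subtype.coe_eta, Equiv.apply_symm_apply]
        · have h2 : ¬ (e₂.symm ⟨y, h⟩ : SuccOrd lam) < A.bound := not_lt.2 (e₂.symm ⟨y, h⟩).2.1
          simp only [dif_neg h, dif_neg h2, Subtype.coe_eta, Equiv.apply_symm_apply] }
  obtain ⟨B, E, hBE⟩ := exists_ordModel_equiv (L := L) e.symm
  have hE : ∀ x, ((E (g x) : B.Carrier) : SuccOrd lam) = x := by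
    intro x
    have h1 : e ⟨x.1, x.2.trans_le hab⟩ = g x := by
      have h2 : x.1 < A.bound := x.2
      simp only [e, Equiv.coe_fn_mk, dif_pos h2]
      rfl
    rw [hBE, ← h1, Equiv.symm_apply_apply]
  have hB : K.Mem B.Carrier := K.mem_iso E hN.1
  exact ⟨B, E, hE, ⟨hB, (Cardinal.mk_congr E.toEquiv).symm.trans hN.2⟩,
    E.toEmbedding.comp g, hE, (isStrongEmb_equiv E hB).comp hg⟩

theorem bound_lt_of_not_surjective {A B : OrdModel L lam} (h : K.OrdLE A B)
    {N : Type u} [L.Structure N] (g : A.Carrier ↪[L] N) (e : N ≃[L] B.Carrier)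
    (he : ∀ x, ((e (g x) : B.Carrier) : SuccOrd lam) = x) (hg : ¬ Function.Surjective g) :
    A.bound < B.bound := by
  refine lt_of_le_of_ne h.bound_le fun heq => hg fun y => ?_
  have h1 : (e y : SuccOrd lam) < A.bound := (e y).2.trans_eq heq.symm
  refine ⟨⟨_, h1⟩, e.injective (Subtype.ext (he _))⟩

section Union

variable {I : Type u} [LinearOrder I]

theorem IncCont.ordLE_of_le {A : I → OrdModel L lam} (hA : K.IncCont A) {i j : I} (h : i ≤ j) :
    K.OrdLE (A i) (A j) := by
  rcases h.eq_or_lt with rfl | h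
  · exact OrdLE.refl (hA.1 i).1
  · exact hA.2.1 i j h

/-- The union of an increasing continuous sequence, carried by a type `V` that is identified with
the union of the universes. -/
theorem IncCont.exists_union [Nonempty I] [WellFoundedLT I] [NoMaxOrder I]
    {A : I → OrdModel L lam} (hA : K.IncCont A) {V : Type u} (v : V → SuccOrd lam)
    (hv : Function.Injective v) (hV : ∀ y, ∃ i, v y < (A i).bound)
    (hV' : ∀ i, ∀ x < (A i).bound, ∃ y, v y = x) :
    ∃ _ : L.Structure V, ∀ i, ∃ f : (A i).Carrier ↪[L] V,
      (∀ x, v (f x) = x) ∧ K.IsStrongEmb f := by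
  classical
  have hidx : ∀ {n : ℕ} (x : Fin n → V), ∃ i, ∀ k, v (x k) < (A i).bound := by
    intro n x
    choose c hc using fun k => hV (x k)
    obtain ⟨i, hi⟩ := Finite.exists_le c
    exact ⟨i, fun k => (hA.ordLE_of_le (hi k)).lt_bound (hc k)⟩
  choose w hw using fun (i : I) (a : (A i).Carrier) => hV' i a.1 a.2
  -- Finitely many arguments lie in one member of the chain, and symbols are evaluated there.
  -- `hlift` compares two such members inside the larger one, so the choice is immaterial.
  let lift : ∀ {n : ℕ} (x : Fin n → V), Fin n → (A (hidx x).choose).Carrier :=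
    fun x k => ⟨v (x k), (hidx x).choose_spec k⟩
  let str : L.Structure V :=
    { funMap := fun f x => w _ (Structure.funMap f (lift x))
      RelMap := fun r x => Structure.RelMap r (lift x) }
  have hlift : ∀ {n : ℕ} (j : I) (a : Fin n → (A j).Carrier), ∃ (m : I)
      (f : (A j).Carrier ↪[L] (A m).Carrier)
      (g : (A (hidx fun k => w j (a k)).choose).Carrier ↪[L] (A m).Carrier),
      (∀ x, (f x : SuccOrd lam) = x) ∧ (∀ x, (g x : SuccOrd lam) = x) ∧
      (fun k => f (a k)) = fun k => g (lift (fun k => w j (a k)) k) := by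
    intro n j a
    obtain ⟨f, hf, -⟩ := hA.ordLE_of_le (le_max_left j (hidx fun k => w j (a k)).choose)
    obtain ⟨g, hg, -⟩ := hA.ordLE_of_le (le_max_right j (hidx fun k => w j (a k)).choose)
    refine ⟨_, f, g, hf, hg, ?_⟩
    funext k
    exact Subtype.ext ((hf _).trans ((hg _).trans (hw _ _)).symm)
  let F : ∀ j, (A j).Carrier ↪[L] V := fun j =>
    { toFun := w j
      inj' := fun a b hab => Subtype.ext (by rw [← hw j a, ← hw j b, hab])
      map_fun' := by
        intro n f a
        obtain ⟨m, g₁, g₂, h₁, h₂, h₃⟩ := hlift j a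
        apply hv
        change v _ = v (w _ (Structure.funMap f (lift fun k => w j (a k))))
        rw [hw, hw, ← h₁, ← h₂, g₁.map_fun, g₂.map_fun]
        exact congrArg (fun z => ((Structure.funMap f z : (A m).Carrier) : SuccOrd lam)) h₃
      map_rel' := by
        intro n r a
        obtain ⟨m, g₁, g₂, h₁, h₂, h₃⟩ := hlift j a
        change Structure.RelMap r (lift fun k => w j (a k)) ↔ _
        rw [← g₁.map_rel, ← g₂.map_rel]
        exact iff_of_eq (congrArg (fun z => Structure.RelMap r z) h₃.symm) }
  have hF : ∀ i j, i < j → ∃ f : (A i).Carrier ↪[L] (A j).Carrier,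
      K.IsStrongEmb f ∧ (F j).comp f = F i := by
    intro i j hij
    obtain ⟨f, hf, hfs⟩ := hA.2.1 i j hij
    refine ⟨f, hfs, ?_⟩
    ext x
    apply hv
    change v (w j (f x)) = v (w i x)
    rw [hw, hw, hf]
  have hmem : ∀ x i, x ∈ (F i).toHom.range ↔ v x < (A i).bound := by
    intro x i
    constructor
    · rintro ⟨a, rfl⟩
      change v (w i a) < _
      rw [hw]
      exact a.2
    · intro h
      exact ⟨⟨_, h⟩, hv (hw i ⟨v x, h⟩)⟩
  refine ⟨str, fun i => ⟨F i, fun x => hw i x, ?_⟩⟩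
  refine strong_of_chain (fun i => (F i).toHom.range)
    (fun i => K.mem_iso (F i).equivRange (hA.1 i).1) ?_ ?_ ?_ i
  · intro i j hij
    obtain ⟨f, hf, hfF⟩ := hF i j hij
    simp only [← hfF]
    refine ⟨range_comp_le _ _, ?_⟩
    rw [comap_range_comp]
    exact K.strong_iso _ hf
  · intro δ hδ x hx
    obtain ⟨i, hi, h⟩ := hA.2.2 δ hδ _ ((hmem x δ).1 hx)
    exact ⟨i, hi, (hmem x i).2 h⟩
  · intro x
    obtain ⟨i, hi⟩ := hV x
    exact ⟨i, (hmem x i).2 hi⟩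

end Union

end AEC

/-! ### Trees of models -/

namespace AEC

open FirstOrder FirstOrder.Language Order

variable {L : FirstOrder.Language.{u, u}} {K : AEC L} {lam : Cardinal.{u}}

variable (K) in
/-- The requirements that being an increasing continuous sequence puts on the `i`-th member. -/
def IncContAt (A : SuccOrd lam → OrdModel L lam) (i : SuccOrd lam) : Prop :=
  K.MemCard lam (A i).Carrier ∧ (∀ j < i, K.OrdLE (A j) (A i)) ∧
    (IsSuccLimit i → ∀ x < (A i).bound, ∃ j < i, x < (A j).bound)

theorem incCont_of_forall {A : SuccOrd lam → OrdModel L lam} (h : ∀ i, K.IncContAt A i) :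
    K.IncCont A :=
  ⟨fun i => (h i).1, fun i j hij => (h j).2.1 i hij, fun δ hδ => (h δ).2.2 hδ⟩

theorem incCont_subtype {A : SuccOrd lam → OrdModel L lam} {s : Set (SuccOrd lam)}
    (hs : IsLowerSet s) (h : ∀ i ∈ s, K.IncContAt A i) : K.IncCont (fun k : s => A k) := by
  refine ⟨fun i => (h i i.2).1, fun i j hij => (h j j.2).2.1 i hij, fun δ hδ x hx => ?_⟩
  have hδ' : IsSuccLimit (δ : SuccOrd lam) := by
    refine ⟨fun hmin => hδ.1 fun b hb => hmin hb, fun a ha => ?_⟩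
    refine hδ.2 ⟨a, hs ha.le δ.2⟩ ⟨ha.lt, fun c hc hcδ => ha.2 hc hcδ⟩
  obtain ⟨j, hj, hx⟩ := (h δ δ.2).2.2 hδ' x hx
  exact ⟨⟨j, hs hj.le δ.2⟩, hj, hx⟩

theorem IncCont.restrict {A : SuccOrd lam → OrdModel L lam} (hA : K.IncCont A)
    {s : Set (SuccOrd lam)} (hs : IsLowerSet s) : K.IncCont (fun k : s => A k) :=
  incCont_subtype hs fun i _ => ⟨hA.1 i, fun j hj => hA.2.1 j i hj, fun hi => hA.2.2 i hi⟩

variable (K) in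
/-- `B` is the union of `⟨A j : j < δ⟩`, as a model in `K_λ`. -/
def IsUnionBelow (A : SuccOrd lam → OrdModel L lam) (δ : SuccOrd lam) (B : OrdModel L lam) : Prop :=
  K.MemCard lam B.Carrier ∧ (∀ j < δ, K.OrdLE (A j) B) ∧
    ∀ x < B.bound, ∃ j < δ, x < (A j).bound

/-- By regularity of λ⁺ the universes below `δ` are bounded. Their least upper bound carries the
union, and it has size λ since it is below λ⁺ and contains a model of size λ. -/
theorem exists_isUnionBelow (hlam : ℵ₀ ≤ lam) {A : SuccOrd lam → OrdModel L lam} {δ : SuccOrd lam}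
    (hδ : IsSuccLimit δ) (hA : ∀ i < δ, K.IncContAt A i) : ∃ B, K.IsUnionBelow A δ B := by
  have hchain : K.IncCont (fun k : Set.Iio δ => A k) := incCont_subtype (isLowerSet_Iio δ) hA
  have : Nonempty (Set.Iio δ) := by
    have := hδ.1
    rw [not_isMin_iff] at this
    obtain ⟨j, hj⟩ := this
    exact ⟨⟨j, hj⟩⟩
  have : NoMaxOrder (Set.Iio δ) := ⟨fun a => by
    obtain ⟨c, hac, hc⟩ := (not_covBy_iff a.2).1 (hδ.2 a.1)
    exact ⟨⟨c, hc⟩, hac⟩⟩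
  obtain ⟨b₀, hb₀⟩ := SuccOrd.exists_gt_of_range hlam (SuccOrd.mk_Iio_le δ)
    (fun j : Set.Iio δ => (A j).bound)
  let U : Set (SuccOrd lam) := {b | ∀ j < δ, (A j).bound ≤ b}
  have hU : U.Nonempty := ⟨b₀, fun j hj => (hb₀ ⟨j, hj⟩).le⟩
  let b := WellFounded.min (wellFounded_lt (α := SuccOrd lam)) U hU
  have hb : ∀ j < δ, (A j).bound ≤ b := WellFounded.min_mem _ U hU
  have hb' : ∀ x < b, ∃ j < δ, x < (A j).bound := by
    intro x hx
    by_contra hcon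
    push Not at hcon
    exact WellFounded.not_lt_min (wellFounded_lt (α := SuccOrd lam)) U hcon hx
  obtain ⟨str, hstr⟩ := hchain.exists_union (V := Set.Iio b) (fun x => x.1)
    Subtype.val_injective (fun y => by
      obtain ⟨j, hj, h⟩ := hb' y.1 y.2
      exact ⟨⟨j, hj⟩, h⟩)
    (fun i x hx => ⟨⟨x, hx.trans_le (hb i i.2)⟩, rfl⟩)
  let B : OrdModel L lam := ⟨b, str⟩
  have hB : ∀ j < δ, K.OrdLE (A j) B := fun j hj => hstr ⟨j, hj⟩
  obtain ⟨⟨j, hj⟩⟩ := ‹Nonempty (Set.Iio δ)›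
  refine ⟨B, ⟨?_, le_antisymm (SuccOrd.mk_Iio_le b) ?_⟩, hB, hb'⟩
  · obtain ⟨f, -, hf⟩ := hB j hj
    exact hf.mem_right
  · exact (hA j hj).1.2.ge.trans (mk_le_mk_of_subset (Set.Iio_subset_Iio (hb j hj)))

variable {β : Type*}

open Classical in
variable (K) in
/-- One step of the construction of a tree of models: given the models at the stages below `i`,
the model at stage `i`. -/
noncomputable def treeStep (G : (j : SuccOrd lam) → (Set.Iic j → OrdModel L lam) → β →
      OrdModel L lam) (A₀ : OrdModel L lam) (η : SuccOrd lam → β) (i : SuccOrd lam)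
    (A : SuccOrd lam → OrdModel L lam) : OrdModel L lam :=
  if IsMin i then A₀
  else if h : ∃ j, j ⋖ i then G h.choose (fun k => A k) (η h.choose)
  -- In the trees built below, the last default is never reached: unions exist at limits once the
  -- earlier stages form a chain.
  else if h : ∃ B, K.IsUnionBelow A i B then h.choose else A₀

open Classical in
/-- A tree of increasing continuous sequences of models, given by its root and by a function that
extends a sequence with a last member in several ways. -/
theorem exists_tree (hlam : ℵ₀ ≤ lam)
    (G : (j : SuccOrd lam) → (Set.Iic j → OrdModel L lam) → β → OrdModel L lam)
    (A₀ : OrdModel L lam) (hA₀ : K.MemCard lam A₀.Carrier)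
    (hG : ∀ j (A : Set.Iic j → OrdModel L lam) b, K.IncCont A →
      (∀ k : Set.Iic j, IsMin k.1 → A k = A₀) →
      K.MemCard lam (G j A b).Carrier ∧ K.OrdLE (A ⟨j, Set.self_mem_Iic⟩) (G j A b) ∧
        (A ⟨j, Set.self_mem_Iic⟩).bound < (G j A b).bound) :
    ∃ A : (SuccOrd lam → β) → SuccOrd lam → OrdModel L lam,
      (∀ η, K.IncCont (A η)) ∧ (∀ η i, IsMin i → A η i = A₀) ∧
      (∀ η j, A η (succ j) = G j (fun k => A η k) (η j)) ∧
      (∀ η ν δ, (∀ x < δ, η x = ν x) → A η δ = A ν δ) ∧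
      (∀ η, StrictMono fun i => (A η i).bound) := by
  have := SuccOrd.noMaxOrder hlam
  let A : (SuccOrd lam → β) → SuccOrd lam → OrdModel L lam := fun η =>
    WellFounded.fix (wellFounded_lt (α := SuccOrd lam)) fun i prev =>
      K.treeStep G A₀ η i fun j => if h : j < i then prev j h else A₀
  have hA : ∀ η i, A η i = K.treeStep G A₀ η i fun j => if j < i then A η j else A₀ :=
    fun η i => by
      simp only [A]
      rw [WellFounded.fix_eq]
      rfl
  have hmin : ∀ η i, IsMin i → A η i = A₀ := fun η i hi => by
    rw [hA, treeStep, if_pos hi]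
  have hsucc : ∀ η j, A η (succ j) = G j (fun k => A η k) (η j) := fun η j => by
    have h : ∃ k, k ⋖ succ j := ⟨j, covBy_succ j⟩
    have hj : h.choose = j := h.choose_spec.unique_left (covBy_succ j)
    rw [hA, treeStep, if_neg (lt_succ j).not_isMin, dif_pos h]
    generalize h.choose = k at hj
    subst hj
    congr 1
    funext x
    rw [if_pos (x.2.trans_lt (lt_succ k))]
  have hlim : ∀ η δ, IsSuccLimit δ → (∃ B, K.IsUnionBelow (A η) δ B) →
      K.IsUnionBelow (A η) δ (A η δ) := fun η δ hδ hB => by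
    have heq : ∀ B, K.IsUnionBelow (fun j => if j < δ then A η j else A₀) δ B ↔
        K.IsUnionBelow (A η) δ B := fun B => by
      refine and_congr Iff.rfl (and_congr ?_ ?_)
      · refine forall₂_congr fun j hj => ?_
        simp only [if_pos hj]
      · refine forall₂_congr fun x _ => exists_congr fun j => and_congr_right fun hj => ?_
        simp only [if_pos hj]
    have hB' : ∃ B, K.IsUnionBelow (fun j => if j < δ then A η j else A₀) δ B := by
      simpa only [heq] using hB
    have hn : ¬ ∃ j, j ⋖ δ := fun ⟨j, hj⟩ => hδ.2 j hj
    rw [← heq, hA η δ, treeStep, if_neg hδ.1, dif_neg hn, dif_pos hB']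
    exact hB'.choose_spec
  -- The recursion carries no proofs, so the chain conditions and the strict growth of the universes
  -- are recovered together by induction.
  have main : ∀ η i, K.IncContAt (A η) i ∧ ∀ j < i, (A η j).bound < (A η i).bound := by
    intro η i
    induction i using WellFoundedLT.induction with
    | ind i ih =>
      rcases isMin_or_mem_range_succ_or_isSuccLimit i with hi | ⟨j, rfl⟩ | hi
      · refine ⟨⟨?_, fun j hj => absurd hj (hi.not_lt), fun h => absurd hi h.1⟩,
          fun j hj => absurd hj (hi.not_lt)⟩
        rw [hmin η i hi]
        exact hA₀
      · obtain ⟨h1, h2, h3⟩ := hG j (fun k => A η k) (η j)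
          (incCont_subtype (isLowerSet_Iic j) fun k hk => (ih k (lt_succ_of_le hk)).1)
          (fun k hk => hmin η k hk)
        rw [← hsucc] at h1 h2 h3
        refine ⟨⟨h1, fun k hk => ?_, fun h => absurd h (not_isSuccLimit_succ j)⟩, fun k hk => ?_⟩
        · rcases (le_of_lt_succ hk).eq_or_lt with rfl | hkj
          · exact h2
          · exact ((ih j (lt_succ j)).1.2.1 k hkj).trans h2
        · rcases (le_of_lt_succ hk).eq_or_lt with rfl | hkj
          · exact h3
          · exact ((ih j (lt_succ j)).2 k hkj).trans h3
      · obtain ⟨h1, h2, h3⟩ := hlim η i hi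
          (exists_isUnionBelow hlam hi fun k hk => (ih k hk).1)
        refine ⟨⟨h1, h2, fun _ => h3⟩, fun j hj => ?_⟩
        have hs := hi.succ_lt hj
        exact ((ih _ hs).2 j (lt_succ j)).trans_le (h2 _ hs).bound_le
  refine ⟨A, fun η => incCont_of_forall fun i => (main η i).1, hmin, hsucc, ?_,
    fun η j i hij => (main η i).2 j hij⟩
  intro η ν δ
  induction δ using WellFoundedLT.induction with
  | ind δ ih =>
    intro h
    have h1 : (fun j => if j < δ then A η j else A₀) = fun j => if j < δ then A ν j else A₀ := by
      funext j
      split_ifs with hj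
      · exact ih j hj fun x hx => h x (hx.trans hj)
      · rfl
    rw [hA, hA, h1, treeStep, treeStep]
    split_ifs with h2 h3 h4
    · rfl
    · rw [h _ h3.choose_spec.lt]
    · rfl
    · rfl

end AEC

/-! ### Closed unbounded sets in λ⁺ -/

namespace SuccOrd

open Order

variable {lam : Cardinal.{u}}

/-- Unboundedness: iterate ω times a step that bounds `g` on the initial segment reached so far, and
take the supremum, which exists because λ⁺ is regular and uncountable. -/
theorem isClub_closed_under (hlam : ℵ₀ ≤ lam) (g : SuccOrd lam → SuccOrd lam) :
    IsClub {δ | ∀ x < δ, g x < δ} := by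
  refine ⟨?_, ?_⟩
  · intro d hd hne _ a ha x hx
    obtain ⟨y, hy, hxy⟩ := (lt_isLUB_iff ha).1 hx
    exact (hd hy x hxy).trans_le (ha.1 hy)
  · intro x₀
    have hstep : ∀ b : SuccOrd lam, ∃ c, b < c ∧ ∀ y < b, g y < c := by
      intro b
      obtain ⟨c, hc⟩ := exists_gt_of_range hlam (mk_Iio_le b) (fun y : Set.Iio b => g y)
      have := noMaxOrder hlam
      obtain ⟨d, hd⟩ := exists_gt (max b c)
      exact ⟨d, (le_max_left _ _).trans_lt hd,
        fun y hy => (hc ⟨y, hy⟩).trans ((le_max_right _ _).trans_lt hd)⟩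
    choose nxt hnxt hnxt' using hstep
    let s : ℕ → SuccOrd lam := fun n => nxt^[n] x₀
    have hs : ∀ n, s (n + 1) = nxt (s n) := fun n => Function.iterate_succ_apply' nxt n x₀
    let U : Set (SuccOrd lam) := {b | ∀ n, s n ≤ b}
    have hU : U.Nonempty := by
      obtain ⟨b, hb⟩ := exists_gt_of_range hlam (ι := ULift ℕ) (by simpa using hlam)
        (fun n => s n.down)
      exact ⟨b, fun n => (hb ⟨n⟩).le⟩
    have hmem := WellFounded.min_mem (wellFounded_lt (α := SuccOrd lam)) U hU
    refine ⟨WellFounded.min (wellFounded_lt (α := SuccOrd lam)) U hU, fun x hx => ?_, hmem 0⟩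
    have : ∃ n, x < s n := by
      by_contra hcon
      push Not at hcon
      exact WellFounded.not_lt_min (wellFounded_lt (α := SuccOrd lam)) U hcon hx
    obtain ⟨n, hn⟩ := this
    refine (hnxt' (s n) x hn).trans_le ?_
    rw [← hs]
    exact hmem (n + 1)

theorem isClub_isSuccLimit (hlam : ℵ₀ ≤ lam) : IsClub {δ : SuccOrd lam | IsSuccLimit δ} := by
  have := noMaxOrder hlam
  have h1 : IsClub {δ : SuccOrd lam | ¬ IsMin δ} := by
    refine ⟨?_, ?_⟩
    · intro d hd ⟨y, hy⟩ _ a ha hmin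
      exact hd hy fun b hb => (hmin (hb.trans (ha.1 hy))).trans' (ha.1 hy)
    · intro x
      exact ⟨succ x, (lt_succ x).not_isMin, le_succ x⟩
  convert! h1.inter (cof_ne_aleph0 hlam) (isClub_closed_under hlam succ) using 1
  ext δ
  refine ⟨fun h => ⟨h.1, fun x hx => h.succ_lt hx⟩, fun h => ⟨h.1, fun a ha => ?_⟩⟩
  exact absurd (h.2 a ha.lt) (not_lt.2 ha.succ_eq.ge)

theorem exists_forall_le (hlam : ℵ₀ ≤ lam) : ∃ r : SuccOrd lam, ∀ x, r ≤ x := by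
  obtain ⟨r, -, hr⟩ := (wellFounded_lt (α := SuccOrd lam)).has_min Set.univ
    ⟨(nonempty hlam).some, Set.mem_univ _⟩
  exact ⟨r, fun x => not_lt.1 (hr x (Set.mem_univ x))⟩

end SuccOrd

/-! ### Trees through copies of a weakly limit model -/

namespace AEC

open FirstOrder FirstOrder.Language Order

variable {L : FirstOrder.Language.{u, u}} {K : AEC L} {lam : Cardinal.{u}}

theorem exists_ordModel_equiv_of_memCard (hlam : ℵ₀ ≤ lam) {M : Type u} [L.Structure M]
    (hM : K.MemCard lam M) :
    ∃ B : OrdModel L lam, Nonempty (M ≃[L] B.Carrier) ∧ K.MemCard lam B.Carrier := by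
  obtain ⟨r, hr⟩ := SuccOrd.exists_forall_le hlam
  obtain ⟨b, -, hb⟩ := SuccOrd.exists_mk_Ico_eq hlam r lam le_rfl
  have hI : Set.Ico r b = Set.Iio b := by
    ext x
    simp [hr]
  rw [hI] at hb
  obtain ⟨e⟩ := Cardinal.eq.1 (hb.trans hM.2.symm)
  obtain ⟨B, E, -⟩ := exists_ordModel_equiv (L := L) e.symm
  exact ⟨B, ⟨E⟩, K.mem_iso E hM.1, (Cardinal.mk_congr E.toEquiv).symm.trans hM.2⟩

/-- An `OrdModel` which is not maximal in `K_λ` has a strictly larger `OrdModel` above it. -/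
theorem exists_ordLE_bound_lt (hlam : ℵ₀ ≤ lam) {B : OrdModel L lam}
    (h : ∃ (N : Type u) (_ : L.Structure N) (f : B.Carrier ↪[L] N),
      K.MemCard lam N ∧ K.IsStrongEmb f ∧ ¬ Function.Surjective f) :
    ∃ D : OrdModel L lam, K.MemCard lam D.Carrier ∧ K.OrdLE B D ∧ B.bound < D.bound := by
  obtain ⟨N, _, f, hN, hf, hns⟩ := h
  obtain ⟨D, e, he, hD, hBD⟩ := exists_ordModel_extension hlam hN f hf
  exact ⟨D, hD, hBD, bound_lt_of_not_surjective hBD f e he hns⟩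

/-- The union of an increasing continuous sequence of length `λ⁺` with strictly increasing
universes is a model of cardinality `λ⁺`, with universe `λ⁺`. -/
theorem IncCont.exists_limit (hlam : ℵ₀ ≤ lam) {A : SuccOrd lam → OrdModel L lam}
    (hA : K.IncCont A) (hmono : StrictMono fun i => (A i).bound) :
    ∃ (N : CategoryTheory.Bundled.{u} L.Structure) (v : N ≃ SuccOrd lam),
      K.MemCard (succ lam) N ∧
      ∀ i, ∃ f : (A i).Carrier ↪[L] N, (∀ x, v (f x) = x) ∧ K.IsStrongEmb f := by
  have := SuccOrd.noMaxOrder hlam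
  have := SuccOrd.nonempty hlam
  obtain ⟨str, hstr⟩ := hA.exists_union (V := SuccOrd lam) id Function.injective_id
    (fun y => ⟨succ y, (lt_succ y).trans_le (hmono.le_apply)⟩) (fun i x _ => ⟨x, rfl⟩)
  refine ⟨⟨SuccOrd lam, str⟩, Equiv.refl _, ⟨?_, SuccOrd.mk_eq⟩, hstr⟩
  obtain ⟨f, -, hf⟩ := hstr (Classical.arbitrary _)
  exact hf.mem_right

section WeaklyLimit

variable {M : Type u} [L.Structure M] {β : Type*}

/-- A tree of sequences that go through copies of a weakly limit model `M`; when they do so at a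
limit stage, they continue with the copy of one of several given extensions of `M`. -/
theorem exists_weaklyLimit_tree (hlam : ℵ₀ ≤ lam) {S : Set (SuccOrd lam)}
    (hM : K.MemCard lam M) (hlim : K.IsWeaklyLimit lam S M)
    (iso : ∀ B : OrdModel L lam, Nonempty (B.Carrier ≃[L] M) → (M ≃[L] B.Carrier))
    (E : β → Type u) [∀ b, L.Structure (E b)] (hE : ∀ b, K.MemCard lam (E b))
    (g : ∀ b, M ↪[L] E b) (hg : ∀ b, K.IsStrongEmb (g b)) :
    ∃ A : (SuccOrd lam → β) → SuccOrd lam → OrdModel L lam,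
      (∀ η, K.IncCont (A η)) ∧
      (∀ η ν δ, (∀ x < δ, η x = ν x) → A η δ = A ν δ) ∧
      (∀ η, StrictMono fun i => (A η i).bound) ∧
      (∀ η, ∃ C, IsClub C ∧ ∀ δ ∈ S ∩ C, Nonempty ((A η δ).Carrier ≃[L] M)) ∧
      ∀ η j, IsSuccLimit j → ∀ h : Nonempty ((A η j).Carrier ≃[L] M),
        ∃ f : E (η j) ↪[L] (A η (succ j)).Carrier, K.IsStrongEmb f ∧
          ∀ x, ((f (g _ x) : (A η (succ j)).Carrier) : SuccOrd lam) = iso _ h x := by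
  obtain ⟨-, -, hproper, F, hF, hFlim⟩ := hlim
  have := SuccOrd.noMaxOrder hlam
  obtain ⟨r, hr⟩ := SuccOrd.exists_forall_le hlam
  have hrmin : IsMin r := fun x _ => hr x
  obtain ⟨A₀, ⟨e₀⟩, hA₀⟩ := exists_ordModel_equiv_of_memCard hlam hM
  have hext : ∀ B : OrdModel L lam, K.MemCard lam B.Carrier → K.Embeds M B.Carrier →
      ∃ D : OrdModel L lam, K.MemCard lam D.Carrier ∧ K.OrdLE B D ∧ B.bound < D.bound :=
    fun B hB hMB => exists_ordLE_bound_lt hlam (hproper _ hB hMB)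
  have hG : ∀ (j : SuccOrd lam) (A : Set.Iic j → OrdModel L lam) (b : β), ∃ B : OrdModel L lam,
      K.IncCont A → (∀ k : Set.Iic j, IsMin k.1 → A k = A₀) →
      (K.MemCard lam B.Carrier ∧ K.OrdLE (A ⟨j, Set.self_mem_Iic⟩) B ∧
        (A ⟨j, Set.self_mem_Iic⟩).bound < B.bound) ∧
      ((∃ k, k ⋖ j) → K.OrdLE (F j A) B) ∧
      ((¬ ∃ k, k ⋖ j) → ∀ h : Nonempty ((A ⟨j, Set.self_mem_Iic⟩).Carrier ≃[L] M),
        ∃ f : E b ↪[L] B.Carrier, K.IsStrongEmb f ∧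
          ∀ x, ((f (g _ x) : B.Carrier) : SuccOrd lam) = iso _ h x) := by
    intro j A b
    by_cases hA : K.IncCont A ∧ ∀ k : Set.Iic j, IsMin k.1 → A k = A₀
    swap
    · exact ⟨A₀, fun h1 h2 => absurd ⟨h1, h2⟩ hA⟩
    obtain ⟨hA, hA0⟩ := hA
    have hAj := hA.1 ⟨j, Set.self_mem_Iic⟩
    have hMA : K.Embeds M (A ⟨j, Set.self_mem_Iic⟩).Carrier := by
      have h1 : K.OrdLE (A ⟨r, hr j⟩) (A ⟨j, Set.self_mem_Iic⟩) := hA.ordLE_of_le (hr j)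
      rw [hA0 _ hrmin] at h1
      exact (Embeds.of_equiv e₀ hA₀.1).trans h1.embeds
    -- `F` must be obeyed only when `j` is a successor; otherwise a copy of `M` may be extended
    -- along `E b`. In each case a further proper extension is added, so that universes grow
    -- strictly.
    by_cases hj : ∃ k, k ⋖ j
    · obtain ⟨hF1, hF2⟩ := hF j A hA
      obtain ⟨B, hB, hFB, hlt⟩ := hext (F j A) hF1 (hMA.trans hF2.embeds)
      exact ⟨B, fun _ _ => ⟨⟨hB, hF2.trans hFB, hF2.bound_le.trans_lt hlt⟩, fun _ => hFB,
        fun h => absurd hj h⟩⟩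
    · by_cases hiso : Nonempty ((A ⟨j, Set.self_mem_Iic⟩).Carrier ≃[L] M)
      · have hs : K.IsStrongEmb ((g b).comp (iso _ hiso).symm.toEmbedding) :=
          (hg b).comp (isStrongEmb_equiv _ hM.1)
        obtain ⟨D, e, he, hD, hAD⟩ := exists_ordModel_extension hlam (hE b) _ hs
        obtain ⟨B, hB, hDB, hlt⟩ := hext D hD (hMA.trans hAD.embeds)
        refine ⟨B, fun _ _ => ⟨⟨hB, hAD.trans hDB, hAD.bound_le.trans_lt hlt⟩,
          fun h => absurd h hj, fun _ h => ?_⟩⟩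
        obtain ⟨i, hi, his⟩ := hDB
        refine ⟨i.comp e.toEmbedding, his.comp (isStrongEmb_equiv e hD.1), fun x => ?_⟩
        have h1 := he (iso _ hiso x)
        change ((e (g b ((iso _ hiso).symm (iso _ hiso x))) : D.Carrier) : SuccOrd lam) = _ at h1
        rw [FirstOrder.Language.Equiv.symm_apply_apply] at h1
        exact (hi _).trans h1
      · obtain ⟨B, hB, hAB, hlt⟩ := hext _ hAj hMA
        exact ⟨B, fun _ _ => ⟨⟨hB, hAB, hlt⟩, fun h => absurd h hj, fun _ h => absurd h hiso⟩⟩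
  choose G hG using hG
  obtain ⟨A, hA, hA0, hsucc, hagree, hmono⟩ := exists_tree hlam G A₀ hA₀
    fun j A b h1 h2 => (hG j A b h1 h2).1
  have hAG := fun η j => hG j (fun k => A η k) (η j) ((hA η).restrict (isLowerSet_Iic j))
    (fun k hk => hA0 η k hk)
  refine ⟨A, hA, hagree, hmono, fun η => ?_, fun η j hj h => ?_⟩
  · refine hFlim (A η) (hA η) (fun i hi => ?_) fun i => ⟨?_, ?_⟩
    · rw [hA0 η i hi]
      exact ⟨e₀.symm⟩
    · exact (hF (succ i) (fun j => A η j) ((hA η).restrict (isLowerSet_Iic _))).2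
    · rw [hsucc η (succ i)]
      exact (hAG η (succ i)).2.1 ⟨i, covBy_succ i⟩
  · have := (hAG η j).2.2 (fun ⟨k, hk⟩ => hj.2 k hk) h
    rw [hsucc η j]
    exact this

end WeaklyLimit

end AEC

/-! ### The weak diamond ideal -/

section WeakDiamond

open Order

variable {lam : Cardinal.{u}}

theorem IsStationary.inter_isClub (hlam : ℵ₀ ≤ lam) {T C : Set (SuccOrd lam)}
    (hT : IsStationary T) (hC : IsClub C) : IsStationary (T ∩ C) := fun t ht => by
  rw [Set.inter_assoc]
  exact hT (hC.inter (SuccOrd.cof_ne_aleph0 hlam) ht)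

theorem not_mem_WDmId {T : Set (SuccOrd lam)} : T ∉ WDmId lam ↔
    ∀ c : (δ : SuccOrd lam) → (Set.Iio δ → SuccOrd lam) → Bool,
      ∃ l : SuccOrd lam → Bool, ∀ η : SuccOrd lam → SuccOrd lam,
        IsStationary {δ | δ ∈ T ∧ c δ (fun x => η x) = l δ} :=
  not_not

theorem mem_WDmId {T : Set (SuccOrd lam)} : T ∈ WDmId lam ↔
    ∃ c : (δ : SuccOrd lam) → (Set.Iio δ → SuccOrd lam) → Bool,
      ∀ l : SuccOrd lam → Bool, ∃ η : SuccOrd lam → SuccOrd lam,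
        ¬ IsStationary {δ | δ ∈ T ∧ c δ (fun x => η x) = l δ} := by
  rw [← not_iff_not, not_mem_WDmId]
  push Not
  rfl

theorem WDmId_mono {T T' : Set (SuccOrd lam)} (h : T ⊆ T') (hT' : T' ∈ WDmId lam) :
    T ∈ WDmId lam := by
  rw [mem_WDmId] at hT' ⊢
  obtain ⟨c, hc⟩ := hT'
  refine ⟨c, fun l => ?_⟩
  obtain ⟨η, hη⟩ := hc l
  exact ⟨η, fun hst => hη (hst.mono fun δ hδ => ⟨h hδ.1, hδ.2⟩)⟩

theorem mem_WDmId_of_not_isStationary {T : Set (SuccOrd lam)} (h : ¬ IsStationary T) :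
    T ∈ WDmId lam :=
  mem_WDmId.2 ⟨fun _ _ => true, fun _ => ⟨id, fun hst => h (hst.mono fun _ hδ => hδ.1)⟩⟩

/-- The weak diamond ideal is closed under unions of at most `λ` members. -/
theorem iUnion_mem_WDmId (hlam : ℵ₀ ≤ lam) {ι : Type u} (hι : #ι ≤ lam)
    (T : ι → Set (SuccOrd lam)) (hT : ∀ i, T i ∈ WDmId lam) : (⋃ i, T i) ∈ WDmId lam := by
  classical
  have hne := SuccOrd.nonempty hlam
  simp only [mem_WDmId] at hT
  choose c hc using hT
  obtain ⟨⟨p, hp⟩⟩ : Nonempty (ι × SuccOrd lam ↪ SuccOrd lam) := by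
    rw [← Cardinal.le_def, mk_prod, lift_id, lift_id, SuccOrd.mk_eq]
    exact mul_le_of_le (hlam.trans (le_succ _)) (hι.trans (le_succ _)) le_rfl
  rw [mem_WDmId]
  -- Through the pairing `p`, one function codes a function for each `i`. The colour at `δ` is that
  -- of a component whose `T i` contains `δ`. On the club `C` of points closed under all `p (i, ·)`,
  -- the restriction to `δ` determines those of the components; off it the default `x.1` is
  -- harmless.
  refine ⟨fun δ q => if h : ∃ i, δ ∈ T i then c h.choose δ fun x =>
    if h' : p (h.choose, x.1) < δ then q ⟨p (h.choose, x.1), h'⟩ else x.1 else true, fun l => ?_⟩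
  choose η hη using fun i => hc i l
  have hι' : Cardinal.lift.{u} #ι < Cardinal.lift.{u} (Order.cof (SuccOrd lam)) := by
    rw [SuccOrd.cof_eq hlam, lift_lt]
    exact hι.trans_lt (lt_succ lam)
  have hcof := SuccOrd.cof_ne_aleph0 hlam
  let C : Set (SuccOrd lam) := ⋂ i, {δ | ∀ x < δ, p (i, x) < δ}
  have hC : IsClub C :=
    IsClub.iInter hcof hι' fun i => SuccOrd.isClub_closed_under hlam fun x => p (i, x)
  let ν : SuccOrd lam → SuccOrd lam := fun y =>
    if h : ∃ z, p z = y then η h.choose.1 h.choose.2 else hne.some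
  have hν : ∀ i x, ν (p (i, x)) = η i x := fun i x => by
    have h : ∃ z, p z = p (i, x) := ⟨_, rfl⟩
    have h2 : h.choose = (i, x) := hp h.choose_spec
    simp only [ν, dif_pos h, h2]
  refine ⟨ν, fun hst => ?_⟩
  have h1 := hst.inter_isClub hlam hC
  have h2 : IsStationary (⋃ i, {δ | δ ∈ T i ∧ c i δ (fun x => η i x) = l δ}) := by
    refine h1.mono ?_
    rintro δ ⟨⟨hδ, hδl⟩, hδC⟩
    have h : ∃ i, δ ∈ T i := Set.mem_iUnion.1 hδ
    beta_reduce at hδl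
    rw [dif_pos h] at hδl
    refine Set.mem_iUnion.2 ⟨h.choose, h.choose_spec, ?_⟩
    rw [← hδl]
    congr 1
    funext x
    have h3 : p (h.choose, x.1) < δ := Set.mem_iInter.1 hδC h.choose x.1 x.2
    rw [dif_pos h3, hν]
  obtain ⟨i, hi⟩ := (isStationary_iUnion_iff hcof hι').1 h2
  exact hη i hi

theorem inter_Ioi_not_mem_WDmId (hlam : ℵ₀ ≤ lam) {S : Set (SuccOrd lam)} (hS : S ∉ WDmId lam)
    (α : SuccOrd lam) : S ∩ Set.Ioi α ∉ WDmId lam := by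
  intro h
  have := SuccOrd.noMaxOrder hlam
  have hclub : IsClub (Set.Ioi α) := by
    refine ⟨?_, fun x => ?_⟩
    · intro d hd ⟨y, hy⟩ _ a ha
      exact (hd hy : α < y).trans_le (ha.1 hy)
    · obtain ⟨b, hb⟩ := exists_gt (max α x)
      exact ⟨b, (le_max_left _ _).trans_lt hb, ((le_max_right _ _).trans_lt hb).le⟩
  have h2 : Set.Iic α ∈ WDmId lam := mem_WDmId_of_not_isStationary fun hst => by
    obtain ⟨x, hx, hx'⟩ := hst hclub
    exact absurd (Set.mem_Iic.1 hx) (not_le.2 hx')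
  have h3 : (⋃ b : ULift.{u} Bool, bif b.down then S ∩ Set.Ioi α else Set.Iic α) ∈ WDmId lam := by
    refine iUnion_mem_WDmId hlam ?_ _ ?_
    · exact (Cardinal.mk_le_aleph0).trans hlam
    · rintro ⟨_ | _⟩
      · exact h2
      · exact h
  refine hS (WDmId_mono (fun x hx => ?_) h3)
  rcases le_or_gt x α with hxα | hxα
  · exact Set.mem_iUnion.2 ⟨⟨false⟩, hxα⟩
  · exact Set.mem_iUnion.2 ⟨⟨true⟩, hx, hxα⟩

/-- A set which is not small splits into `λ⁺` pairwise disjoint sets which are not small. -/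
theorem exists_disjoint_not_mem_WDmId (hlam : ℵ₀ ≤ lam) {S : Set (SuccOrd lam)}
    (hS : S ∉ WDmId lam) : ∃ T : SuccOrd lam → Set (SuccOrd lam), (∀ i, T i ⊆ S) ∧
      (∀ i j δ, δ ∈ T i → δ ∈ T j → i = j) ∧ ∀ i, T i ∉ WDmId lam := by
  have he : ∀ β : SuccOrd lam, Nonempty (Set.Iio β ↪ lam.out) := fun β => by
    rw [← Cardinal.le_def, mk_out]
    exact SuccOrd.mk_Iio_le β
  -- An Ulam matrix. The sets `U α ζ` over all `ζ` cover `S` above `α`, so one of them is not small.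
  -- For fixed `ζ` they are disjoint, since each `he β` gives an injection. Some `ζ` serves λ⁺ many
  -- `α`.
  let U : SuccOrd lam → lam.out → Set (SuccOrd lam) := fun α ζ =>
    {β | β ∈ S ∧ ∃ h : α < β, (he β).some ⟨α, h⟩ = ζ}
  have hU : ∀ α, ∃ ζ, U α ζ ∉ WDmId lam := by
    intro α
    by_contra hcon
    push Not at hcon
    refine inter_Ioi_not_mem_WDmId hlam hS α
      (WDmId_mono (fun β hβ => ?_) (iUnion_mem_WDmId hlam (mk_out lam).le (U α) hcon))
    exact Set.mem_iUnion.2 ⟨_, hβ.1, hβ.2, rfl⟩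
  choose ζ hζ using hU
  obtain ⟨z, hz⟩ := infinite_pigeonhole_card ζ (succ lam) SuccOrd.mk_eq.ge
    (hlam.trans (le_succ _)) (by
      rw [mk_out, (SuccOrd.isRegular_succ hlam).cof_ord]
      exact lt_succ lam)
  rw [← SuccOrd.mk_eq (lam := lam)] at hz
  obtain ⟨i⟩ := hz
  refine ⟨fun a => U (i a) z, fun a β hβ => hβ.1, ?_, fun a => ?_⟩
  · rintro a b β ⟨-, h1, h2⟩ ⟨-, h3, h4⟩
    have h5 := (he β).some.injective (h2.trans h4.symm)
    exact i.injective (Subtype.ext (Subtype.mk.inj h5))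
  · have := hζ (i a)
    rwa [show ζ (i a) = z from (i a).2] at this

/-- The guessing property of sets which are not small, for properties of sequences of elements of
an arbitrary set of size `≤ λ⁺`. -/
theorem exists_guess {T : Set (SuccOrd lam)} (hT : T ∉ WDmId lam)
    {X : Type u} [Nonempty X] (hX : #X ≤ succ lam) (R : SuccOrd lam → (SuccOrd lam → X) → Prop) :
    ∃ l : SuccOrd lam → Bool, ∀ q : SuccOrd lam → X,
      IsStationary {δ | δ ∈ T ∧ ((∃ q', (∀ x < δ, q' x = q x) ∧ R δ q') ↔ l δ = true)} := by
  classical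
  rw [← SuccOrd.mk_eq (lam := lam)] at hX
  obtain ⟨i⟩ := hX
  obtain ⟨l, hl⟩ := not_mem_WDmId.1 hT fun δ p =>
    decide (∃ q', (∀ x : Set.Iio δ, q' x = Function.invFun i (p x)) ∧ R δ q')
  refine ⟨l, fun q => (hl fun x => i (q x)).mono ?_⟩
  rintro δ ⟨hδT, hδ⟩
  refine ⟨hδT, ?_⟩
  rw [← hδ, decide_eq_true_iff]
  refine exists_congr fun q' => and_congr_left fun _ => ?_
  simp [Function.leftInverse_invFun i.injective _]

end WeakDiamond

/-! ### Guessing embeddings between ends of branches -/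

namespace AEC

open FirstOrder FirstOrder.Language Order

variable {L : FirstOrder.Language.{u, u}} {K : AEC L} {lam : Cardinal.{u}}

theorem IncCont.bound_le_of_closed {A : SuccOrd lam → OrdModel L lam} (hA : K.IncCont A)
    {δ : SuccOrd lam} (hδ : IsSuccLimit δ) (h : ∀ x < δ, (A x).bound < δ) : (A δ).bound ≤ δ := by
  by_contra hcon
  obtain ⟨i, hi, hlt⟩ := hA.2.2 δ hδ δ (not_le.1 hcon)
  exact lt_irrefl _ (hlt.trans (h i hi))

/-- A strong embedding whose range lies in a strong submodel factors through it. -/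
theorem IsStrongEmb.exists_factor {E A N : Type u} [L.Structure E] [L.Structure A] [L.Structure N]
    {k : E ↪[L] N} {i : A ↪[L] N} (hk : K.IsStrongEmb k) (hi : K.IsStrongEmb i)
    (h : ∀ x, ∃ a, i a = k x) : ∃ k' : E ↪[L] A, K.IsStrongEmb k' ∧ ∀ x, i (k' x) = k x := by
  have h' : ∀ x, k x ∈ i.toHom.range := fun x => h x
  let k' : E ↪[L] A := i.equivRange.symm.toEmbedding.comp (k.codRestrict i.toHom.range h')
  have hk' : ∀ x, i (k' x) = k x := fun x =>
    congrArg Subtype.val (i.equivRange.apply_symm_apply (k.codRestrict i.toHom.range h' x))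
  have hcomp : i.comp k' = k := by
    ext x
    exact hk' x
  exact ⟨k', hi.of_comp (hcomp ▸ hk), hk'⟩

/-- A tree of models in `K_λ` together with the models `N η ∈ K_{λ⁺}` at the ends of its branches.
On a club relative to `S`, the models along a branch `η` are copies of `M`, and at such stages `δ`
the branch goes through the extension `E (η δ)` of `M`. -/
structure WeaklyLimitTree (K : AEC L) (lam : Cardinal.{u}) (S : Set (SuccOrd lam)) (M : Type u)
    [L.Structure M] {β : Type} (E : β → Type u) [∀ b, L.Structure (E b)] (g : ∀ b, M ↪[L] E b) where
  /-- The models in the tree. -/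
  A : (SuccOrd lam → β) → SuccOrd lam → OrdModel L lam
  /-- The models at the ends of the branches. -/
  N : (SuccOrd lam → β) → CategoryTheory.Bundled.{u} L.Structure
  /-- The identification of the universe of a model with `λ⁺`. -/
  v : ∀ η, N η ≃ SuccOrd lam
  /-- A choice of isomorphisms from `M` to its copies. -/
  iso : ∀ B : OrdModel L lam, Nonempty (B.Carrier ≃[L] M) → (M ≃[L] B.Carrier)
  incCont : ∀ η, K.IncCont (A η)
  agree : ∀ η ν δ, (∀ x < δ, η x = ν x) → A η δ = A ν δ
  mono : ∀ η, StrictMono fun i => (A η i).bound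
  club : ∀ η, ∃ C, IsClub C ∧ ∀ δ ∈ S ∩ C, Nonempty ((A η δ).Carrier ≃[L] M)
  memCard : ∀ η, K.MemCard (succ lam) (N η)
  inc : ∀ η i, ∃ f : (A η i).Carrier ↪[L] N η, (∀ x, v η (f x) = x) ∧ K.IsStrongEmb f
  emb : ∀ η δ, IsSuccLimit δ → ∀ h : Nonempty ((A η δ).Carrier ≃[L] M),
    ∃ k : E (η δ) ↪[L] N η, K.IsStrongEmb k ∧ ∀ x, v η (k (g _ x)) = iso _ h x

section

variable {M : Type u} [L.Structure M] {S : Set (SuccOrd lam)} {β : Type} {E : β → Type u}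
  [∀ b, L.Structure (E b)] {g : ∀ b, M ↪[L] E b}

theorem exists_weaklyLimitTree (hlam : ℵ₀ ≤ lam)
    (hM : K.MemCard lam M) (hlim : K.IsWeaklyLimit lam S M)
    (hE : ∀ b, K.MemCard lam (E b)) (hg : ∀ b, K.IsStrongEmb (g b)) :
    Nonempty (WeaklyLimitTree K lam S M E g) := by
  -- The isomorphism depends on the model and not on the branch: branches that agree below `δ` share
  -- the same copy of `M` at `δ`, pointwise.
  let iso : ∀ B : OrdModel L lam, Nonempty (B.Carrier ≃[L] M) → (M ≃[L] B.Carrier) :=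
    fun B h => h.some.symm
  obtain ⟨A, hA, hagree, hmono, hclub, hext⟩ :=
    exists_weaklyLimit_tree hlam hM hlim iso E hE g hg
  choose N v hN hinc using fun η => (hA η).exists_limit hlam (hmono η)
  refine ⟨⟨A, N, v, iso, hA, hagree, hmono, hclub, hN, hinc, fun η δ hδ h => ?_⟩⟩
  obtain ⟨f, hf, hfx⟩ := hext η δ hδ h
  obtain ⟨i, hi, his⟩ := hinc η (succ δ)
  exact ⟨i.comp f, his.comp hf, fun x => (hi _).trans (hfx x)⟩

namespace WeaklyLimitTree

variable (T : WeaklyLimitTree K lam S M E g)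

theorem iso_congr {B B' : OrdModel L lam} (hB : B = B') (h : Nonempty (B.Carrier ≃[L] M))
    (h' : Nonempty (B'.Carrier ≃[L] M)) (x : M) :
    ((T.iso B h x : B.Carrier) : SuccOrd lam) = T.iso B' h' x := by
  subst hB
  rfl

/-- The stages at which the `η`-branch of the tree goes through a copy of `M` with universe
the ordinal of the stage. -/
def Through (η : SuccOrd lam → β) (δ : SuccOrd lam) : Prop :=
  IsSuccLimit δ ∧ (T.A η δ).bound ≤ δ ∧ Nonempty ((T.A η δ).Carrier ≃[L] M)

theorem exists_club_through (hlam : ℵ₀ ≤ lam) (η : SuccOrd lam → β) :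
    ∃ C, IsClub C ∧ ∀ δ ∈ S ∩ C, T.Through η δ := by
  obtain ⟨C, hC, h⟩ := T.club η
  have hcof := SuccOrd.cof_ne_aleph0 hlam
  refine ⟨_, (hC.inter hcof (SuccOrd.isClub_isSuccLimit hlam)).inter hcof
    (SuccOrd.isClub_closed_under hlam fun x => (T.A η x).bound), ?_⟩
  rintro δ ⟨hS, ⟨hδC, hδ⟩, hcl⟩
  exact ⟨hδ, (T.incCont η).bound_le_of_closed hδ hcl, h δ ⟨hS, hδC⟩⟩

theorem Through.congr {η ν : SuccOrd lam → β} {δ : SuccOrd lam} (h : T.Through η δ)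
    (hην : ∀ x < δ, η x = ν x) : T.Through ν δ := by
  rw [Through, ← T.agree η ν δ hην]
  exact h

theorem exists_emb {η : SuccOrd lam → β} {δ : SuccOrd lam} (h : T.Through η δ) {b : β}
    (hb : η δ = b) : ∃ k : E b ↪[L] T.N η, K.IsStrongEmb k ∧
      ∀ x, T.v η (k (g _ x)) = T.iso _ h.2.2 x := by
  subst hb
  exact T.emb η δ h.1 h.2.2

theorem exists_range_le (hlam : ℵ₀ ≤ lam) (η : SuccOrd lam → β) {X : Type u} (hX : #X ≤ lam)
    (k : X → T.N η) : ∃ α, ∀ β, α ≤ β → ∀ x, T.v η (k x) < (T.A η β).bound := by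
  obtain ⟨α, hα⟩ := SuccOrd.exists_gt_of_range hlam hX fun x => T.v η (k x)
  exact ⟨α, fun β hβ x => (hα x).trans_le (hβ.trans (T.mono η).le_apply)⟩

/-- Two strong embeddings of models of size `λ` into `N ν` factor through a common strong submodel
of size `λ`. -/
theorem exists_common_factor (hlam : ℵ₀ ≤ lam) (ν : SuccOrd lam → β) {X Y : Type u}
    [L.Structure X] [L.Structure Y] (hX : #X ≤ lam) (hY : #Y ≤ lam)
    {k : X ↪[L] T.N ν} {j : Y ↪[L] T.N ν} (hk : K.IsStrongEmb k) (hj : K.IsStrongEmb j) :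
    ∃ (D : OrdModel L lam) (k' : X ↪[L] D.Carrier) (j' : Y ↪[L] D.Carrier),
      K.MemCard lam D.Carrier ∧ K.IsStrongEmb k' ∧ K.IsStrongEmb j' ∧
      ∀ x y, k x = j y → k' x = j' y := by
  obtain ⟨α, hα⟩ := T.exists_range_le hlam ν hX k
  obtain ⟨β, hβ⟩ := T.exists_range_le hlam ν hY j
  obtain ⟨i, hi, his⟩ := T.inc ν (max α β)
  obtain ⟨k', hk', hk'x⟩ := hk.exists_factor his fun x =>
    ⟨⟨_, hα _ (le_max_left _ _) x⟩, (T.v ν).injective (hi _)⟩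
  obtain ⟨j', hj', hj'x⟩ := hj.exists_factor his fun x =>
    ⟨⟨_, hβ _ (le_max_right _ _) x⟩, (T.v ν).injective (hi _)⟩
  exact ⟨T.A ν (max α β), k', j', (T.incCont ν).1 _, hk', hj', fun x y hxy =>
    i.injective (by rw [hk'x, hj'x, hxy])⟩

section

variable {E : Option Bool → Type u} [∀ b, L.Structure (E b)] {g : ∀ b, M ↪[L] E b}
  (T : WeaklyLimitTree K lam S M E g)

/-- If `N` is universal in `K_{λ⁺}`, then two extensions of `M` as used in the tree can be
amalgamated. -/
theorem exists_amalgam_of_universal (hlam : ℵ₀ ≤ lam) (hS : S ∉ WDmId lam) {P : Type u}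
    [L.Structure P] (hP : #P = succ lam) (hemb : ∀ η, K.Embeds (T.N η) P) :
    ∃ (f₀ : E (some false) ↪[L] P) (f₁ : E (some true) ↪[L] P), K.IsStrongEmb f₀ ∧ K.IsStrongEmb f₁ ∧
      ∀ x, f₀ (g (some false) x) = f₁ (g (some true) x) := by
  have hne := SuccOrd.nonempty hlam
  obtain ⟨u⟩ := Cardinal.eq.1 (hP.trans SuccOrd.mk_eq.symm)
  let R : SuccOrd lam → (SuccOrd lam → Option Bool × SuccOrd lam) → Prop := fun δ q =>
    ∃ η : SuccOrd lam → Option Bool, (∀ x, (q x).1 = η x) ∧ η δ = some false ∧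
      ∃ f : T.N η ↪[L] P, K.IsStrongEmb f ∧ ∀ x, (q x).2 = u (f ((T.v η).symm x))
  obtain ⟨l, hl⟩ := exists_guess hS (X := Option Bool × SuccOrd lam) (by
    rw [mk_prod, lift_uzero, SuccOrd.mk_eq]
    refine mul_le_of_le (hlam.trans (le_succ _)) ?_ le_rfl
    exact (lift_le_aleph0.2 mk_le_aleph0).trans (hlam.trans (le_succ _))) R
  -- The branch opposes the guess: if the restriction to `δ` is guessed to extend to a pair taking
  -- `some false` at `δ`, the branch takes `some true` there.
  obtain ⟨f, hf⟩ := hemb fun x => some (l x)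
  obtain ⟨C, hC, hCl⟩ := T.exists_club_through hlam fun x => some (l x)
  obtain ⟨δ, ⟨hδS, hδ⟩, hδC⟩ := hl (fun x => (some (l x), u (f ((T.v fun x => some (l x)).symm x)))) hC
  have hth := hCl δ ⟨hδS, hδC⟩
  by_cases hlδ : l δ = true
  · obtain ⟨q, hq, η, hqη, hηδ, f', hf', hqf⟩ := hδ.2 hlδ
    have hag : ∀ x < δ, some (l x) = η x := fun x hx => by rw [← hqη, hq x hx]
    have hth' := hth.congr T hag
    obtain ⟨k₁, hk₁, hk₁x⟩ := T.exists_emb hth (congrArg some hlδ)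
    obtain ⟨k₀, hk₀, hk₀x⟩ := T.exists_emb hth' hηδ
    refine ⟨f'.comp k₀, f.comp k₁, hf'.comp hk₀, hf.comp hk₁, fun x => u.injective ?_⟩
    have hlt : ((T.iso _ hth.2.2 x : (T.A (fun x => some (l x)) δ).Carrier) : SuccOrd lam) < δ :=
      (T.iso _ hth.2.2 x).2.trans_le hth.2.1
    have h1 := hqf (T.iso _ hth.2.2 x)
    rw [hq _ hlt] at h1
    simp only [← hk₁x] at h1
    rw [Equiv.symm_apply_apply, hk₁x, T.iso_congr (T.agree _ η δ hag) hth.2.2 hth'.2.2, ← hk₀x,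
      Equiv.symm_apply_apply] at h1
    exact h1.symm
  -- Otherwise the branch takes `some false` at `δ` and, with `f`, is itself the extension that the
  -- guess denies.
  · exact absurd (hδ.1 ⟨_, fun x _ => rfl, fun x => some (l x), fun x => rfl, by simpa using hlδ, f, hf,
      fun x => rfl⟩) hlδ

open Classical in
/-- Suppose that any two extensions of `E none` can be amalgamated over `M` while `E (some false)` and
`E (some true)` cannot.  Then there are models `N η`, indexed by the sets of ordinals `< λ⁺`, such that
embeddability implies inclusion of indices. -/
theorem exists_family (hlam : ℵ₀ ≤ lam) (hS : S ∉ WDmId lam) (hE : ∀ b, K.MemCard lam (E b))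
    (hamal : ∀ (D₁ D₂ : Type u) [L.Structure D₁] [L.Structure D₂], K.MemCard lam D₁ →
      K.MemCard lam D₂ → ∀ (j₁ : E none ↪[L] D₁) (j₂ : E none ↪[L] D₂),
      K.IsStrongEmb j₁ → K.IsStrongEmb j₂ →
      ∃ (P : Type u) (_ : L.Structure P) (h₁ : D₁ ↪[L] P) (h₂ : D₂ ↪[L] P),
        K.IsStrongEmb h₁ ∧ K.IsStrongEmb h₂ ∧
          ∀ x, h₁ (j₁ (g none x)) = h₂ (j₂ (g none x)))
    (hna : ¬ ∃ (P : Type u) (_ : L.Structure P) (f₀ : E (some false) ↪[L] P) (f₁ : E (some true) ↪[L] P),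
      K.IsStrongEmb f₀ ∧ K.IsStrongEmb f₁ ∧ ∀ x, f₀ (g (some false) x) = f₁ (g (some true) x)) :
    ∃ η : Set (SuccOrd lam) → SuccOrd lam → Option Bool,
      ∀ X Y, K.Embeds (T.N (η X)) (T.N (η Y)) → X ⊆ Y := by
  have hne := SuccOrd.nonempty hlam
  have hcof := SuccOrd.cof_ne_aleph0 hlam
  obtain ⟨U, hUS, hUdisj, hU⟩ := exists_disjoint_not_mem_WDmId hlam hS
  let R : SuccOrd lam → (SuccOrd lam → (Option Bool × Option Bool) × SuccOrd lam) → Prop := fun δ q =>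
    ∃ η ν : SuccOrd lam → Option Bool, (∀ x, (q x).1 = (η x, ν x)) ∧ η δ = some false ∧ ν δ = none ∧
      ∃ f : T.N η ↪[L] T.N ν, K.IsStrongEmb f ∧ ∀ x, (q x).2 = T.v ν (f ((T.v η).symm x))
  choose l hl using fun i => exists_guess (hU i) (X := (Option Bool × Option Bool) × SuccOrd lam) (by
    rw [mk_prod, lift_uzero, SuccOrd.mk_eq]
    refine mul_le_of_le (hlam.trans (le_succ _)) ?_ le_rfl
    exact (lift_le_aleph0.2 mk_le_aleph0).trans (hlam.trans (le_succ _))) R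
  let η : Set (SuccOrd lam) → SuccOrd lam → Option Bool := fun X δ =>
    if h : ∃ i ∈ X, δ ∈ U i then some (l h.choose δ) else none
  refine ⟨η, fun X Y hXY i hiX => ?_⟩
  by_contra hiY
  obtain ⟨ν, hν⟩ : ∃ ν, ν = η Y := ⟨_, rfl⟩
  rw [← hν] at hXY
  obtain ⟨f, hf⟩ := hXY
  let φ : SuccOrd lam → SuccOrd lam := fun x => T.v ν (f ((T.v (η X)).symm x))
  obtain ⟨C₁, hC₁, hC₁X⟩ := T.exists_club_through hlam (η X)
  obtain ⟨C₂, hC₂, hC₂Y⟩ := T.exists_club_through hlam ν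
  obtain ⟨δ, ⟨hδU, hδ⟩, ⟨hδ₁, hδ₂⟩, hδφ⟩ := hl i (fun x => ((η X x, ν x), φ x))
    ((hC₁.inter hcof hC₂).inter hcof (SuccOrd.isClub_closed_under hlam φ))
  have hX : η X δ = some (l i δ) := by
    have h : ∃ i ∈ X, δ ∈ U i := ⟨i, hiX, hδU⟩
    simp only [η, dif_pos h]
    rw [hUdisj _ i δ h.choose_spec.2 hδU]
  have hY : ν δ = none := by
    rw [hν]
    refine dif_neg ?_
    rintro ⟨j, hjY, hj⟩
    rw [hUdisj i j δ hδU hj] at hiY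
    exact hiY hjY
  have hth₁ := hC₁X δ ⟨hUS i hδU, hδ₁⟩
  have hth₂ := hC₂Y δ ⟨hUS i hδU, hδ₂⟩
  by_cases hlδ : l i δ = true
  swap
  · exact hlδ (hδ.1 ⟨_, fun x _ => rfl, η X, ν, fun x => rfl, by rw [hX]; simpa using hlδ, hY, f,
      hf, fun x => rfl⟩)
  obtain ⟨q, hq, η', ν', hqη, hη', hν', f', hf', hqf⟩ := hδ.2 hlδ
  have hag₁ : ∀ x < δ, η X x = η' x := fun x hx => by
    have := hqη x
    rw [hq x hx] at this
    exact congrArg Prod.fst this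
  have hag₂ : ∀ x < δ, ν x = ν' x := fun x hx => by
    have := hqη x
    rw [hq x hx] at this
    exact congrArg Prod.snd this
  have hth₁' := hth₁.congr T hag₁
  have hth₂' := hth₂.congr T hag₂
  obtain ⟨k, hk, hkx⟩ := T.exists_emb hth₁ (hX.trans (congrArg some hlδ))
  obtain ⟨k', hk', hkx'⟩ := T.exists_emb hth₁' hη'
  obtain ⟨j, hj, hjx⟩ := T.exists_emb hth₂ hY
  obtain ⟨j', hj', hjx'⟩ := T.exists_emb hth₂' hν'
  -- `hamal` needs models of size λ, so `N ν` and `N ν'` are cut down to `D` and `D'`. Each contains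
  -- a copy of `E none` and the image of `E (some true)`, respectively `E (some false)`.
  obtain ⟨D, kD, jD, hD, hkD, hjD, hD'⟩ := T.exists_common_factor hlam ν (hE _).2.le (hE _).2.le
    (hf.comp hk) hj
  obtain ⟨D', kD', jD', hDm', hkD', hjD', hD''⟩ := T.exists_common_factor hlam ν' (hE _).2.le
    (hE _).2.le (hf'.comp hk') hj'
  obtain ⟨P, _, h₁, h₂, hh₁, hh₂, hh⟩ := hamal _ _ hD hDm' jD jD' hjD hjD'
  refine hna ⟨P, _, h₂.comp kD', h₁.comp kD, hh₂.comp hkD', hh₁.comp hkD, fun x => ?_⟩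
  let w : SuccOrd lam := (T.iso _ hth₁.2.2 x : (T.A (η X) δ).Carrier)
  have hw : w < δ := (T.iso _ hth₁.2.2 x).2.trans_le hth₁.2.1
  -- Since `δ` is closed under `φ`, the copy of `M` on the first branch is mapped into the copy of
  -- `M` on `ν`, over which `D` and `D'` are amalgamated.
  have hφw : φ w < (T.A ν δ).bound := (hδφ w hw).trans_le (T.mono ν).le_apply
  obtain ⟨z, hz⟩ := (T.iso _ hth₂.2.2).surjective ⟨φ w, hφw⟩
  have e₁ : kD (g (some true) x) = jD (g none z) := by
    refine hD' _ _ ((T.v ν).injective ?_)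
    rw [hjx, hz]
    change T.v ν (f (k (g (some true) x))) = φ w
    simp only [φ, w, ← hkx, Equiv.symm_apply_apply]
  have e₂ : kD' (g (some false) x) = jD' (g none z) := by
    refine hD'' _ _ ((T.v ν').injective ?_)
    rw [hjx', ← T.iso_congr (T.agree _ _ δ hag₂) hth₂.2.2, hz]
    change T.v ν' (f' (k' (g (some false) x))) = φ w
    have h1 := hqf w
    rw [hq w hw] at h1
    refine Eq.trans ?_ h1.symm
    simp only [w]
    rw [T.iso_congr (T.agree _ _ δ hag₁) hth₁.2.2 hth₁'.2.2, ← hkx', Equiv.symm_apply_apply]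
  change h₂ (kD' (g (some false) x)) = h₁ (kD (g (some true) x))
  rw [e₁, e₂, hh]

end

end WeaklyLimitTree

end

end AEC

/-! ### Hajnal's free set theorem -/

section FreeSet

open Order

/-- Recursive choice along a well-order. -/
theorem exists_forall_of_step {I : Type*} [LinearOrder I] [WellFoundedLT I] {β : Type*} [Nonempty β]
    (R : I → (I → β) → β → Prop)
    (hcongr : ∀ i P P' Q, (∀ j < i, P j = P' j) → R i P Q → R i P' Q)
    (h : ∀ i P, (∀ j < i, R j P (P j)) → ∃ Q, R i P Q) : ∃ P : I → β, ∀ i, R i P (P i) := by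
  classical
  have h' : ∀ i P, ∃ Q, (∀ j < i, R j P (P j)) → R i P Q := fun i P => by
    by_cases hP : ∀ j < i, R j P (P j)
    · obtain ⟨Q, hQ⟩ := h i P hP
      exact ⟨Q, fun _ => hQ⟩
    · exact ⟨Classical.arbitrary β, fun h => absurd h hP⟩
  choose nxt hnxt using h'
  let P : I → β := WellFounded.fix (wellFounded_lt (α := I)) fun i prev =>
    nxt i fun j => if hj : j < i then prev j hj else Classical.arbitrary β
  have hP : ∀ i, P i = nxt i fun j => if j < i then P j else Classical.arbitrary β := fun i => by
    simp only [P]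
    rw [WellFounded.fix_eq]
    rfl
  refine ⟨P, fun i => ?_⟩
  induction i using WellFoundedLT.induction with
  | ind i ih =>
    have hag : ∀ j < i, (if j < i then P j else Classical.arbitrary β) = P j := fun j hj =>
      if_pos hj
    rw [hP i]
    refine hcongr i _ P _ hag (hnxt i _ fun j hj => ?_)
    simp only [if_pos hj]
    exact hcongr j P _ _ (fun k hk => (hag k (hk.trans hj)).symm) (ih j hj)

variable {α : Type u}

/-- A set is free for a set mapping `F` if no element of it belongs to the image of another one. -/
def IsFreeFor (F : α → Set α) (s : Set α) : Prop :=
  ∀ x ∈ s, ∀ y ∈ s, x ≠ y → y ∉ F x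

theorem exists_maximal_isFreeFor (F : α → Set α) (D : Set α) :
    ∃ s ⊆ D, IsFreeFor F s ∧ ∀ x ∈ D, x ∉ s → ∃ a ∈ s, a ∈ F x ∨ x ∈ F a := by
  obtain ⟨s, hs⟩ := zorn_subset {s : Set α | s ⊆ D ∧ IsFreeFor F s} fun c hc hchain => by
    refine ⟨⋃₀ c, ⟨Set.sUnion_subset fun t ht => (hc ht).1, ?_⟩, fun t ht =>
      Set.subset_sUnion_of_mem ht⟩
    rintro x ⟨t, ht, hx⟩ y ⟨t', ht', hy⟩ hxy
    rcases hchain.total ht ht' with h | h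
    · exact (hc ht').2 x (h hx) y hy hxy
    · exact (hc ht).2 x hx y (h hy) hxy
  refine ⟨s, hs.prop.1, hs.prop.2, fun x hx hxs => ?_⟩
  by_contra hcon
  push Not at hcon
  refine hxs (hs.le_of_ge (y := insert x s) ⟨Set.insert_subset hx hs.prop.1, ?_⟩
    (Set.subset_insert x s) (Set.mem_insert x s))
  rintro a (rfl | ha) b (rfl | hb) hab
  · exact absurd rfl hab
  · exact (hcon b hb).1
  · exact (hcon a ha).2
  · exact hs.prop.2 a ha b hb hab

theorem mk_biUnion_lt_of_le {F : α → Set α} {κ μ : Cardinal.{u}} (hκ : ℵ₀ ≤ κ) (hκμ : κ < μ)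
    (hF : ∀ x, #(F x) ≤ κ) {V : Set α} (hV : #V < μ) : #(⋃ a ∈ V, F a : Set α) < μ := by
  rw [Set.biUnion_eq_iUnion]
  refine (mk_iUnion_le _).trans_lt ?_
  refine mul_lt_of_lt (hκ.trans hκμ.le) hV ((ciSup_le' fun a : V => hF a).trans_lt hκμ)

/-- Hajnal's free set theorem inside a set of regular cardinality. -/
theorem exists_isFreeFor_of_isRegular {F : α → Set α} {κ : Cardinal.{u}} (hκ : ℵ₀ ≤ κ)
    (hF : ∀ x, #(F x) ≤ κ) {D : Set α} (hD : (#D).IsRegular) (hκD : succ κ < #D) :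
    ∃ s ⊆ D, #s = #D ∧ IsFreeFor F s := by
  by_contra hcon
  push Not at hcon
  have hsmall : ∀ s ⊆ D, IsFreeFor F s → #s < #D := fun s hs hfree =>
    lt_of_le_of_ne (mk_le_mk_of_subset hs) fun h => hcon s hs h hfree
  let I := SuccOrd κ
  have hI : #I = succ κ := SuccOrd.mk_eq
  -- Choose κ⁺ disjoint sets `A i`, each a maximal free subset of what is left of `D`. Their union
  -- and its image under `F` do not exhaust `D`. For a remaining `x`, maximality puts a point of
  -- every `A i` into `F x`, which is too many.
  obtain ⟨A, hA⟩ := exists_forall_of_step (I := I) (β := Set α)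
    (fun i P Q => Q ⊆ D \ ⋃ j ∈ Set.Iio i, P j ∧ IsFreeFor F Q ∧
      ∀ x ∈ D \ ⋃ j ∈ Set.Iio i, P j, x ∉ Q → ∃ a ∈ Q, a ∈ F x ∨ x ∈ F a)
    (fun i P P' Q h => by
      have : (⋃ j ∈ Set.Iio i, P j) = ⋃ j ∈ Set.Iio i, P' j :=
        Set.iUnion₂_congr fun j hj => h j hj
      simp only [this]
      exact id)
    (fun i P _ => exists_maximal_isFreeFor F _)
  have hAD : ∀ i, A i ⊆ D := fun i => (hA i).1.trans Set.sdiff_subset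
  have hU : #(⋃ i, A i) < #D :=
    (card_iUnion_lt_iff_forall_of_isRegular hD (hI.trans_lt hκD)).2 fun i =>
      hsmall _ (hAD i) (hA i).2.1
  have hFU := mk_biUnion_lt_of_le hκ ((lt_succ κ).trans hκD) hF hU
  obtain ⟨x, hxD, hx⟩ : ∃ x ∈ D, x ∉ (⋃ i, A i) ∪ ⋃ a ∈ ⋃ i, A i, F a := by
    by_contra h
    push Not at h
    have h1 := mk_le_mk_of_subset (show D ⊆ _ from h)
    exact absurd (h1.trans (mk_union_le _ _)) (not_le.2 (add_lt_of_lt hD.aleph0_le hU hFU))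
  have hxU : ∀ i, x ∉ A i := fun i hi => hx (Or.inl (Set.mem_iUnion.2 ⟨i, hi⟩))
  have key : ∀ i, ∃ a ∈ A i, a ∈ F x := fun i => by
    obtain ⟨a, ha, h | h⟩ := (hA i).2.2 x ⟨hxD, fun h => by
      obtain ⟨j, -, hj⟩ := Set.mem_iUnion₂.1 h
      exact hxU j hj⟩ (hxU i)
    · exact ⟨a, ha, h⟩
    · exact absurd (Or.inr (Set.mem_iUnion₂.2 ⟨a, Set.mem_iUnion.2 ⟨i, ha⟩, h⟩)) hx
  choose a haA haF using key
  have hne : ∀ i j, i < j → a i ≠ a j := fun i j hij h =>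
    ((hA j).1 (haA j)).2 (Set.mem_iUnion₂.2 ⟨i, hij, h ▸ haA i⟩)
  have hinj : Function.Injective fun i => (⟨a i, haF i⟩ : F x) := fun i j hij => by
    have h := congrArg Subtype.val hij
    rcases lt_trichotomy i j with h' | h' | h'
    · exact absurd h (hne i j h')
    · exact h'
    · exact absurd h.symm (hne j i h')
  exact absurd ((hI.ge.trans (mk_le_of_injective hinj)).trans (hF x)) (not_le.2 (lt_succ κ))

theorem exists_cofinal_cardinals {μ : Cardinal.{u}} :
    ∃ c : μ.ord.cof.ord.ToType → Cardinal.{u}, (∀ i, c i < μ) ∧ ∀ ν < μ, ∃ i, ν ≤ c i := by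
  obtain ⟨s, hs, hsμ⟩ := Order.exists_cof_eq (α := μ.ord.ToType)
  rw [Ordinal.cof_toType] at hsμ
  obtain ⟨e⟩ : Nonempty (μ.ord.cof.ord.ToType ≃ s) := Cardinal.eq.1 (by simp [hsμ])
  have hlt : ∀ x : μ.ord.ToType, #(Set.Iio x) < μ := fun x => by
    simpa using mk_Iio_lt (α := μ.ord.ToType) x (by simp)
  refine ⟨fun i => #(Set.Iio (e i : μ.ord.ToType)), fun i => hlt _, fun ν hν => ?_⟩
  let t : μ.ord.ToType := Ordinal.ToType.mk ⟨ν.ord, ord_lt_ord.2 hν⟩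
  obtain ⟨y, hy, hty⟩ := hs t
  refine ⟨e.symm ⟨y, hy⟩, ?_⟩
  simp only [Equiv.apply_symm_apply]
  refine le_trans ?_ (mk_le_mk_of_subset (Set.Iio_subset_Iio hty))
  let f : Set.Iio ν.ord → Set.Iio t := fun o =>
    ⟨Ordinal.ToType.mk ⟨o.1, o.2.trans (ord_lt_ord.2 hν)⟩, by
      rw [Set.mem_Iio, OrderIso.lt_iff_lt]
      exact o.2⟩
  have hf : Function.Injective f := fun a b hab => by
    have h1 := Ordinal.ToType.mk.injective (congrArg Subtype.val hab)
    exact Subtype.ext (Subtype.mk.inj h1)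
  have h2 := mk_le_of_injective (α := ULift.{u + 1} (Set.Iio ν.ord))
    (β := ULift.{u + 1} (Set.Iio t)) (f := fun o => ⟨f o.down⟩)
    (fun a b hab => ULift.ext _ _ (hf (congrArg ULift.down hab)))
  rw [mk_uLift, mk_uLift, mk_Iio_ordinal, card_ord] at h2
  simpa using h2

/-- Hajnal's free set theorem, the singular case. -/
theorem exists_isFreeFor_of_isSingular {F : α → Set α} {κ : Cardinal.{u}} (hκ : ℵ₀ ≤ κ)
    (hF : ∀ x, #(F x) ≤ κ) (hα : (#α).IsSingular) (hκα : κ < #α) :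
    ∃ s : Set α, #s = #α ∧ IsFreeFor F s := by
  set μ := #α with hμ
  set θ := μ.ord.cof with hθ
  have hμ₀ : ℵ₀ ≤ μ := hκ.trans hκα.le
  set κ' := max κ θ with hκ'
  have hκ₀ : ℵ₀ ≤ κ' := hκ.trans (le_max_left _ _)
  have hκ'μ : κ' < μ := max_lt hκα hα.cof_ord_lt
  have hlim : ∀ ν < μ, succ ν < μ := fun ν hν => hα.isSuccLimit.succ_lt hν
  obtain ⟨c, hcμ, hc⟩ := exists_cofinal_cardinals (μ := μ)
  let I := θ.ord.ToType
  have hI : #I = θ := by simp [I]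
  have hIio : ∀ i : I, #(Set.Iio i) < θ := fun i => by
    simpa [I] using mk_Iio_lt (α := I) i (by simp [I])
  let m : I → Cardinal.{u} := fun i => succ (max (c i) (succ κ'))
  have hmμ : ∀ i, m i < μ := fun i => hlim _ (max_lt (hcμ i) (hlim _ hκ'μ))
  have hκm : ∀ i, succ κ' < m i := fun i => lt_succ_of_le (le_max_right _ _)
  have hm₀ : ∀ i, ℵ₀ ≤ m i := fun i => hκ₀.trans ((lt_succ κ').trans (hκm i)).le
  have hm : ∀ i, (m i).IsRegular := fun i =>
    Cardinal.isRegular_succ ((hκ₀.trans (le_succ κ')).trans (le_max_right _ _))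
  let J := SuccOrd κ'
  have hJ : #J = succ κ' := SuccOrd.mk_eq
  -- Row `i` consists of κ'⁺ disjoint columns of size `m i`. It avoids the images of earlier rows,
  -- and beyond some column `ξ₀` its own images avoid the earlier rows. One column `ξ` beyond all
  -- the `ξ₀` then gives the free set.
  let R : I → (I → J → Set α) → (J → Set α) → Prop := fun i P Q =>
    (∀ ξ ζ x, x ∈ Q ξ → x ∈ Q ζ → ξ = ζ) ∧ (∀ ξ, m i ≤ #(Q ξ)) ∧ #(⋃ ξ, Q ξ) ≤ m i ∧
    IsFreeFor F (⋃ ξ, Q ξ) ∧ (∀ j < i, ∀ ξ ζ, ∀ y ∈ P j ξ, ∀ x ∈ Q ζ, x ∉ F y) ∧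
    ∃ ξ₀, ∀ j < i, ∀ ξ > ξ₀, ∀ y ∈ P j ξ, ∀ ζ, ∀ x ∈ Q ζ, y ∉ F x
  obtain ⟨P, hP⟩ := exists_forall_of_step R (by
    rintro i P P' Q h ⟨h1, h2, h3, h4, h5, ξ₀, h6⟩
    refine ⟨h1, h2, h3, h4, fun j hj => ?_, ξ₀, fun j hj => ?_⟩
    · rw [← h j hj]
      exact h5 j hj
    · rw [← h j hj]
      exact h6 j hj) (by
    intro i P hP
    have hV : #(⋃ j : Set.Iio i, ⋃ ξ, P j ξ) < μ := by
      refine (mk_iUnion_le _).trans_lt (mul_lt_of_lt hμ₀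
        ((hIio i).trans hα.cof_ord_lt) (iSup_lt_of_lt_cof_ord (hIio i) fun j => ?_))
      exact ((hP j j.2).2.2.1).trans_lt (hmμ _)
    set V : Set α := ⋃ j : Set.Iio i, ⋃ ξ, P j ξ with hVdef
    have hFV := mk_biUnion_lt_of_le hκ hκα hF hV
    have : Infinite α := Cardinal.infinite_iff.2 hμ₀
    have hcompl := mk_compl_of_infinite (⋃ a ∈ V, F a) hFV
    obtain ⟨D, hDsub, hD⟩ := le_mk_iff_exists_subset.1 ((hmμ i).le.trans hcompl.ge)
    obtain ⟨A, hAD, hA, hAfree⟩ := exists_isFreeFor_of_isRegular hκ hF (D := D)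
      (by rw [hD]; exact hm i)
      (by rw [hD]; exact (succ_le_succ (le_max_left κ θ)).trans_lt (hκm i))
    rw [hD] at hA
    -- The columns of an earlier row are disjoint, so `F x` meets at most `κ` of them; there are
    -- fewer than `θ` earlier rows, hence at most `κ'` bad columns.
    have hbad : ∀ x, ∃ ξ₀ : J, ∀ ξ > ξ₀, ∀ j < i, ∀ y ∈ P j ξ, y ∉ F x := by
      intro x
      have hb : #(⋃ j : Set.Iio i, {ξ : J | (F x ∩ P j ξ).Nonempty}) ≤ κ' := by
        refine (mk_iUnion_le _).trans (mul_le_of_le hκ₀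
          ((hIio i).le.trans (le_max_right _ _)) (ciSup_le' fun j => ?_))
        have hne : ∀ ξ : {ξ : J | (F x ∩ P j ξ).Nonempty}, (F x ∩ P j ξ).Nonempty := fun ξ => ξ.2
        choose y hy using hne
        refine (mk_le_of_injective (f := fun ξ => (⟨y ξ, (hy ξ).1⟩ : F x))
          fun ξ ζ h => ?_).trans ((hF x).trans (le_max_left _ _))
        have h' : y ξ = y ζ := congrArg Subtype.val h
        exact Subtype.ext ((hP j j.2).1 _ _ (y ξ) (hy ξ).2 (h' ▸ (hy ζ).2))
      obtain ⟨ξ₀, hξ₀⟩ := SuccOrd.exists_gt_of_card_le hκ₀ _ hb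
      refine ⟨ξ₀, fun ξ hξ j hj y hy hyx => ?_⟩
      exact lt_asymm hξ (hξ₀ ξ (Set.mem_iUnion.2 ⟨⟨j, hj⟩, y, hyx, hy⟩))
    choose ξ₀ hξ₀ using hbad
    obtain ⟨z, hz⟩ := infinite_pigeonhole (fun x : A => ξ₀ x) (by rw [hA]; exact hm₀ i)
      (by rw [hA, (hm i).cof_ord, hJ]; exact hκm i)
    let B : Set α := Subtype.val '' ((fun x : A => ξ₀ x) ⁻¹' {z})
    have hB : #B = m i := by
      rw [mk_image_eq Subtype.val_injective, hz, hA]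
    have hBA : B ⊆ A := by
      rintro _ ⟨x, -, rfl⟩
      exact x.2
    have hBz : ∀ x ∈ B, ξ₀ x = z := by
      rintro _ ⟨x, hx, rfl⟩
      exact hx
    obtain ⟨e⟩ : Nonempty (J × B ≃ B) := Cardinal.eq.1 (by
      rw [mk_prod, lift_id, lift_id, hB, hJ]
      exact mul_eq_right (hm₀ i) (hκm i).le (succ_ne_zero κ'))
    let Q : J → Set α := fun ξ => Set.range fun b : B => (e (ξ, b) : α)
    have hQB : ∀ ξ, Q ξ ⊆ B := by
      rintro ξ _ ⟨b, rfl⟩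
      exact (e (ξ, b)).2
    refine ⟨Q, ?_, fun ξ => ?_, ?_, ?_, ?_, z, ?_⟩
    · rintro ξ ζ _ ⟨b, rfl⟩ ⟨b', h⟩
      have := e.injective (Subtype.ext h)
      exact (congrArg Prod.fst this).symm
    · rw [← hB]
      refine mk_le_of_injective (f := fun b : B => (⟨_, b, rfl⟩ : Q ξ)) fun b b' h => ?_
      have h1 : (e (ξ, b) : α) = e (ξ, b') := Subtype.mk.inj h
      exact congrArg Prod.snd (e.injective (Subtype.ext h1))
    · exact (mk_le_mk_of_subset (Set.iUnion_subset hQB)).trans hB.le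
    · intro x hx y hy
      exact hAfree x (hBA (Set.iUnion_subset hQB hx)) y (hBA (Set.iUnion_subset hQB hy))
    · intro j hj ξ ζ y hy x hx hxy
      refine hDsub (hAD (hBA (hQB ζ hx))) (Set.mem_iUnion₂.2 ⟨y, ?_, hxy⟩)
      exact Set.mem_iUnion.2 ⟨⟨j, hj⟩, Set.mem_iUnion.2 ⟨ξ, hy⟩⟩
    · intro j hj ξ hξ y hy ζ x hx
      exact hξ₀ x ξ (by rw [hBz x (hQB ζ hx)]; exact hξ) j hj y hy)
  choose hdisj hcard hle hfree hup ξ₀ hdown using hP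
  obtain ⟨ξ, hξ⟩ := SuccOrd.exists_gt_of_range hκ₀ (hI.le.trans (le_max_right κ θ)) ξ₀
  refine ⟨⋃ i, P i ξ, le_antisymm (mk_set_le _) (le_of_forall_lt fun ν hν => ?_), ?_⟩
  · obtain ⟨i, hi⟩ := hc ν hν
    exact (lt_succ_of_le (hi.trans (le_max_left _ _))).trans_le
      ((hcard i ξ).trans (mk_le_mk_of_subset (Set.subset_iUnion (fun i => P i ξ) i)))
  · intro x hx y hy hxy
    obtain ⟨i, hi⟩ := Set.mem_iUnion.1 hx
    obtain ⟨j, hj⟩ := Set.mem_iUnion.1 hy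
    rcases lt_trichotomy i j with h | rfl | h
    · exact hup j i h ξ ξ x hi y hj
    · exact hfree i x (Set.mem_iUnion.2 ⟨ξ, hi⟩) y (Set.mem_iUnion.2 ⟨ξ, hj⟩) hxy
    · exact hdown i j h ξ (hξ i) y hj ξ x hi

/-- **Hajnal's free set theorem**: a set mapping on `α` with values of size `≤ κ`, where
`κ⁺ < |α|`, has a free set of size `|α|`. -/
theorem exists_isFreeFor {F : α → Set α} {κ : Cardinal.{u}} (hκ : ℵ₀ ≤ κ)
    (hF : ∀ x, #(F x) ≤ κ) (hκα : succ κ < #α) : ∃ s : Set α, #s = #α ∧ IsFreeFor F s := by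
  have h₀ : ℵ₀ ≤ #α := hκ.trans ((lt_succ κ).trans hκα).le
  rcases isRegular_or_isSingular h₀ with h | h
  · obtain ⟨s, -, hs, hfree⟩ := exists_isFreeFor_of_isRegular (D := Set.univ) hκ hF
      (by rwa [mk_univ]) (by rwa [mk_univ])
    exact ⟨s, by rw [hs, mk_univ], hfree⟩
  · exact exists_isFreeFor_of_isSingular hκ hF h ((lt_succ κ).trans hκα)

end FreeSet

/-! ### Models that are incompatible over `M`, and counting -/

namespace AEC

open FirstOrder FirstOrder.Language Order CategoryTheory

variable {L : FirstOrder.Language.{u, u}} {K : AEC L} {lam : Cardinal.{u}}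

theorem LS_mem (K : AEC L) : ℵ₀ ≤ K.LS ∧ L.card ≤ K.LS :=
  have h := csInf_mem (s := {κ : Cardinal.{u} | ℵ₀ ≤ κ ∧ L.card ≤ κ ∧
    ∀ (N : Type u) [L.Structure N], K.Mem N → ∀ A : Set N, #A ≤ κ →
      ∃ S : L.Substructure N, K.Strong N S ∧ A ⊆ S ∧ #S ≤ κ}) K.exists_LS
  ⟨h.1, h.2.1⟩

variable (K) in
/-- `B₀` and `B₁` cannot be amalgamated so that the elements below `b` are identified. -/
def NotAmalgamable (b : SuccOrd lam) (B₀ B₁ : OrdModel L lam) : Prop :=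
  ¬ ∃ (P : Type u) (_ : L.Structure P) (h₀ : B₀.Carrier ↪[L] P) (h₁ : B₁.Carrier ↪[L] P),
    K.IsStrongEmb h₀ ∧ K.IsStrongEmb h₁ ∧
      ∀ (y₀ : B₀.Carrier) (y₁ : B₁.Carrier), (y₀ : SuccOrd lam) = y₁ →
        (y₀ : SuccOrd lam) < b → h₀ y₀ = h₁ y₁

section Splitting

variable {M : Type u} [L.Structure M]

/-- If every extension of `M` in `K_λ` has two extensions that cannot be amalgamated over `M`,
then there are models `N η ∈ K_{λ⁺}` containing `M`, for `η : λ⁺ → 2`, which are pairwise not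
embeddable over `M` into one model. -/
theorem exists_pairwise_not_amalgamable (hlam : ℵ₀ ≤ lam) (hM : K.MemCard lam M)
    (hproper : ∀ (M₁ : Type u) [L.Structure M₁], K.MemCard lam M₁ → K.Embeds M M₁ →
      ∃ (N : Type u) (_ : L.Structure N) (f : M₁ ↪[L] N),
        K.MemCard lam N ∧ K.IsStrongEmb f ∧ ¬ Function.Surjective f)
    (hsplit : ∀ (N : Type u) [L.Structure N] (g : M ↪[L] N), K.MemCard lam N → K.IsStrongEmb g →
      ∃ (D : Bool → Bundled.{u} L.Structure) (j : ∀ b, N ↪[L] D b),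
        (∀ b, K.MemCard lam (D b)) ∧ (∀ b, K.IsStrongEmb (j b)) ∧
        ¬ ∃ (P : Type u) (_ : L.Structure P) (h₀ : D false ↪[L] P) (h₁ : D true ↪[L] P),
          K.IsStrongEmb h₀ ∧ K.IsStrongEmb h₁ ∧ ∀ x, h₀ (j false (g x)) = h₁ (j true (g x))) :
    ∃ (N : (SuccOrd lam → Bool) → Bundled.{u} L.Structure) (k : ∀ η, M → N η),
      (∀ η, K.MemCard (succ lam) (N η)) ∧
      ∀ η ν, η ≠ ν → ∀ (P : Type u) [L.Structure P] (f : N η ↪[L] P) (f' : N ν ↪[L] P),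
        K.IsStrongEmb f → K.IsStrongEmb f' → ¬ ∀ x, f (k η x) = f' (k ν x) := by
  have := SuccOrd.noMaxOrder hlam
  obtain ⟨r, hr⟩ := SuccOrd.exists_forall_le hlam
  have hrmin : IsMin r := fun x _ => hr x
  obtain ⟨A₀, ⟨e₀⟩, hA₀⟩ := exists_ordModel_equiv_of_memCard hlam hM
  have hG : ∀ (j : SuccOrd lam) (A : Set.Iic j → OrdModel L lam), ∃ B : Bool → OrdModel L lam,
      K.IncCont A → (∀ k : Set.Iic j, IsMin k.1 → A k = A₀) →
      (∀ b, K.MemCard lam (B b).Carrier ∧ K.OrdLE (A ⟨j, Set.self_mem_Iic⟩) (B b) ∧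
        (A ⟨j, Set.self_mem_Iic⟩).bound < (B b).bound) ∧
      K.NotAmalgamable A₀.bound (B false) (B true) := by
    intro j A
    by_cases hA : K.IncCont A ∧ ∀ k : Set.Iic j, IsMin k.1 → A k = A₀
    swap
    · exact ⟨fun _ => A₀, fun h1 h2 => absurd ⟨h1, h2⟩ hA⟩
    obtain ⟨hA, hA0⟩ := hA
    have h1 : K.OrdLE (A ⟨r, hr j⟩) (A ⟨j, Set.self_mem_Iic⟩) := hA.ordLE_of_le (hr j)
    rw [hA0 _ hrmin] at h1
    obtain ⟨i, hi, his⟩ := h1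
    have hg := his.comp (isStrongEmb_equiv e₀ hA₀.1)
    obtain ⟨D, d, hD, hd, hna⟩ := hsplit _ _ (hA.1 ⟨j, Set.self_mem_Iic⟩) hg
    choose B e he hB hAB using fun b => exists_ordModel_extension hlam (hD b) (d b) (hd b)
    choose B' hB' hBB' hlt using fun b => exists_ordLE_bound_lt hlam
      (hproper _ (hB b) (Embeds.trans ⟨_, hg⟩ (hAB b).embeds))
    refine ⟨B', fun _ _ => ⟨fun b => ⟨hB' b, (hAB b).trans (hBB' b),
      (hAB b).bound_le.trans_lt (hlt b)⟩, ?_⟩⟩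
    rintro ⟨P, _, h₀, h₁, hh₀, hh₁, hh⟩
    choose u hu hus using hBB'
    have hval : ∀ b x, ((u b (e b (d b (i (e₀ x)))) : (B' b).Carrier) : SuccOrd lam) = e₀ x :=
      fun b x => (hu b _).trans ((he b _).trans (hi _))
    refine hna ⟨P, _, h₀.comp ((u false).comp (e false).toEmbedding),
      h₁.comp ((u true).comp (e true).toEmbedding),
      hh₀.comp ((hus false).comp (isStrongEmb_equiv _ (hB false).1)),
      hh₁.comp ((hus true).comp (isStrongEmb_equiv _ (hB true).1)), fun x => ?_⟩
    refine hh _ _ ((hval false x).trans (hval true x).symm) ?_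
    exact (hval false x).trans_lt (e₀ x).2
  choose G hG using hG
  obtain ⟨A, hA, hA0, hsucc, hagree, hmono⟩ := exists_tree (K := K) hlam (fun j A b => G j A b) A₀
    hA₀ fun j A b h1 h2 => (hG j A h1 h2).1 b
  choose N v hN hinc using fun η => (hA η).exists_limit hlam (hmono η)
  have hroot : ∀ η, ∃ f : A₀.Carrier ↪[L] N η, ∀ x, v η (f x) = x := fun η => by
    obtain ⟨f, hf, -⟩ := hinc η r
    have h := hA0 η r hrmin
    generalize A η r = A' at f hf h
    subst h
    exact ⟨f, hf⟩
  choose k hk using hroot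
  have key : ∀ η ν δ, (∀ x < δ, η x = ν x) → η δ = false → ν δ = true →
      ∀ (P : Type u) [L.Structure P] (f : N η ↪[L] P) (f' : N ν ↪[L] P),
        K.IsStrongEmb f → K.IsStrongEmb f' → ¬ ∀ x, f (k η (e₀ x)) = f' (k ν (e₀ x)) := by
    intro η ν δ hag hη hν P _ f f' hf hf' hff'
    have h1 := (hG δ (fun j => A η j) ((hA η).restrict (isLowerSet_Iic δ))
      (fun j hj => hA0 η j hj)).2
    have h2 : (fun j : Set.Iic δ => A η j) = fun j : Set.Iic δ => A ν j := by
      funext j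
      exact hagree η ν j fun x hx => hag x (hx.trans_le j.2)
    have h3 := hsucc η δ
    have h4 := hsucc ν δ
    rw [hη] at h3
    rw [hν, ← h2] at h4
    rw [← h3, ← h4] at h1
    obtain ⟨i, hi, his⟩ := hinc η (succ δ)
    obtain ⟨i', hi', his'⟩ := hinc ν (succ δ)
    refine h1 ⟨P, _, f.comp i, f'.comp i', hf.comp his, hf'.comp his', fun y₀ y₁ hy hlt => ?_⟩
    obtain ⟨x, hx⟩ := e₀.surjective ⟨y₀, hlt⟩
    have h5 : i y₀ = k η (e₀ x) := (v η).injective (by rw [hi, hk, hx])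
    have h6 : i' y₁ = k ν (e₀ x) := (v ν).injective (by rw [hi', hk, hx, hy])
    change f (i y₀) = f' (i' y₁)
    rw [h5, h6, hff']
  refine ⟨N, fun η x => k η (e₀ x), hN, fun η ν hne P _ f f' hf hf' hff' => ?_⟩
  -- At the first difference `δ` the branches share stage `δ`, and their next stages are its two
  -- successors, incompatible over the root.
  obtain ⟨δ, hδ, hmin⟩ := (wellFounded_lt (α := SuccOrd lam)).has_min {x | η x ≠ ν x}
    (Function.ne_iff.1 hne)
  have hag : ∀ x < δ, η x = ν x := fun x hx => not_not.1 fun h => hmin x h hx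
  cases hη : η δ
  · exact key η ν δ hag hη (by simpa [hη] using Ne.symm hδ) P f f' hf hf' hff'
  · exact key ν η δ (fun x hx => (hag x hx).symm) (by simpa [hη] using Ne.symm hδ) hη P f' f hf' hf
      fun x => (hff' x).symm

end Splitting

theorem succ_power_le (hlam : ℵ₀ ≤ lam) : succ lam ^ lam ≤ 2 ^ lam := by
  calc succ lam ^ lam ≤ (2 ^ lam) ^ lam :=
        power_le_power_right (succ_le_of_lt (cantor lam))
    _ = 2 ^ lam := by rw [← power_mul, mul_eq_self hlam]

/-- Models containing `M` which are pairwise not embeddable over `M` into one model: at most `2^λ`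
of them are embeddable into a given model of size `λ⁺`. -/
theorem mk_setOf_embeds_le (hlam : ℵ₀ ≤ lam) {M : Type u} (hM : #M = lam) {ι : Type u}
    {N : ι → Bundled.{u} L.Structure} {k : ∀ i, M → N i}
    (h : ∀ i j, i ≠ j → ∀ (P : Type u) [L.Structure P] (f : N i ↪[L] P) (f' : N j ↪[L] P),
        K.IsStrongEmb f → K.IsStrongEmb f' → ¬ ∀ x, f (k i x) = f' (k j x))
    {P : Type u} [L.Structure P] (hP : #P = succ lam) :
    #{i | K.Embeds (N i) P} ≤ 2 ^ lam := by
  have hemb : ∀ i : {i | K.Embeds (N i) P}, K.Embeds (N i) P := fun i => i.2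
  choose f hf using hemb
  -- Two members of the family with the same restriction to `M` would embed over `M` into `P`, so
  -- the index is determined by a function from `M` to `P`.
  refine (mk_le_of_injective (f := fun i => fun x => f i (k i x)) fun i j hij => ?_).trans
    (?_ : #(M → P) ≤ _)
  · by_contra hne
    exact h i j (fun h => hne (Subtype.ext h)) P (f i) (f j) (hf i) (hf j) (congrFun hij)
  · rw [← power_def, hP, hM]
    exact succ_power_le hlam

/-- A structure amounts to a function into λ⁺ and a set, each on at most λ⁺ pairs of a symbol and a
tuple of arguments. -/
theorem mk_structure_le (hlam : ℵ₀ ≤ lam) (hL : L.card ≤ lam) :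
    #(L.Structure (SuccOrd lam)) ≤ 2 ^ succ lam := by
  have hs : ℵ₀ ≤ succ lam := hlam.trans (le_succ lam)
  have hne := SuccOrd.nonempty hlam
  have hlist : #(List (SuccOrd lam)) = succ lam := by
    have : Infinite (SuccOrd lam) := Cardinal.infinite_iff.2 (by rwa [SuccOrd.mk_eq])
    rw [mk_list_eq_mk, SuccOrd.mk_eq]
  have hsig : ∀ R : ℕ → Type u, #(Σ n, R n) ≤ lam →
      #(Σ n, R n × (Fin n → SuccOrd lam)) ≤ succ lam := by
    intro R hR
    refine (mk_le_of_injective (β := (Σ n, R n) × List (SuccOrd lam))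
      (f := fun p => (⟨p.1, p.2.1⟩, List.ofFn p.2.2)) ?_).trans ?_
    · rintro ⟨n, f, x⟩ ⟨m, f', x'⟩ h
      simp only [Prod.mk.injEq, Sigma.mk.injEq] at h
      obtain ⟨⟨rfl, hf⟩, hx⟩ := h
      rw [eq_of_heq hf, List.ofFn_injective hx]
    · rw [mk_prod, lift_id, lift_id, hlist]
      exact mul_le_of_le hs (hR.trans (le_succ lam)) le_rfl
  have hF : #(Σ n, L.Functions n) ≤ lam :=
    (mk_le_of_injective (f := Sum.inl) Sum.inl_injective).trans hL
  have hR : #(Σ n, L.Relations n) ≤ lam :=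
    (mk_le_of_injective (f := Sum.inr) Sum.inr_injective).trans hL
  refine (mk_le_of_injective (β := ((Σ n, L.Functions n × (Fin n → SuccOrd lam)) → SuccOrd lam) ×
    Set (Σ n, L.Relations n × (Fin n → SuccOrd lam)))
    (f := fun s => (fun p => s.funMap p.2.1 p.2.2, {p | s.RelMap p.2.1 p.2.2})) ?_).trans ?_
  · rintro ⟨F₁, R₁⟩ ⟨F₂, R₂⟩ h
    simp only [Prod.mk.injEq] at h
    congr 1
    · funext n f x
      exact congrFun h.1 ⟨n, f, x⟩
    · funext n r x
      exact congrArg (fun s : Set _ => (⟨n, r, x⟩ : Σ n, L.Relations n × (Fin n → _)) ∈ s) h.2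
  · have h2 : (2 : Cardinal.{u}) ^ succ lam * 2 ^ succ lam = 2 ^ succ lam := by
      rw [← power_add, add_eq_self hs]
    rw [mk_prod, lift_id, lift_id, ← power_def, mk_set, SuccOrd.mk_eq, ← h2]
    refine mul_le_mul' ?_ (power_le_power_left two_ne_zero (hsig _ hR))
    calc succ lam ^ #(Σ n, L.Functions n × (Fin n → SuccOrd lam)) ≤ succ lam ^ succ lam :=
          power_le_power_left (succ_ne_zero _) (hsig _ hF)
      _ = 2 ^ succ lam := power_self_eq hs

theorem mk_isoTypes_le (hlam : ℵ₀ ≤ lam) (hL : L.card ≤ lam) :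
    #(K.isoTypes (succ lam)) ≤ Cardinal.lift.{u + 1} ((2 : Cardinal.{u}) ^ succ lam) := by
  let q : L.Structure (SuccOrd lam) → Quotient
      (FirstOrder.Language.equivSetoid : Setoid (Bundled.{u} L.Structure)) := fun s =>
    ⟦⟨SuccOrd lam, s⟩⟧
  have hsub : K.isoTypes (succ lam) ⊆ Set.range q := by
    rintro _ ⟨N, hN, rfl⟩
    obtain ⟨e⟩ := Cardinal.eq.1 (hN.2.trans SuccOrd.mk_eq.symm)
    refine ⟨Equiv.inducedStructure e, Eq.symm (Quotient.sound ?_)⟩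
    exact ⟨@Equiv.inducedStructureEquiv L N (SuccOrd lam) _ e⟩
  have h := mk_range_le_lift (f := q)
  rw [lift_id'.{u, u + 1}] at h
  exact (mk_le_mk_of_subset hsub).trans (h.trans (lift_le.2 (mk_structure_le hlam hL)))

/-- A family of `2^(λ⁺)` models each of which is isomorphic to at most `2^λ` members of the family
represents `2^(λ⁺)` isomorphism types. -/
theorem le_mk_isoTypes (hlam : ℵ₀ ≤ lam) (hpow : (2 : Cardinal.{u}) ^ lam < 2 ^ succ lam)
    {ι : Type u} (hι : #ι = 2 ^ succ lam) (N : ι → Bundled.{u} L.Structure)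
    (hN : ∀ i, K.MemCard (succ lam) (N i))
    (h : ∀ i, #{j | K.Embeds (N j) (N i)} ≤ 2 ^ lam) :
    Cardinal.lift.{u + 1} ((2 : Cardinal.{u}) ^ succ lam) ≤ #(K.isoTypes (succ lam)) := by
  let s : Setoid ι := FirstOrder.Language.equivSetoid.comap N
  have hfib : ∀ c : Quotient s, #((Quotient.mk s) ⁻¹' {c}) ≤ 2 ^ lam := by
    intro c
    induction c using Quotient.inductionOn with
    | h i =>
      refine (mk_le_mk_of_subset fun j hj => ?_).trans (h i)
      obtain ⟨e⟩ : Nonempty (N j ≃[L] N i) := Quotient.exact (s := s) hj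
      exact Embeds.of_equiv e (hN i).1
  have hQ : 2 ^ succ lam ≤ #(Quotient s) := by
    by_contra hcon
    have h1 := mk_le_mk_mul_of_mk_preimage_le (Quotient.mk s) hfib
    have h0 : ℵ₀ ≤ (2 : Cardinal.{u}) ^ succ lam :=
      (hlam.trans (le_succ lam)).trans (cantor _).le
    rw [hι] at h1
    exact absurd h1 (not_le.2 (mul_lt_of_lt h0 (not_le.1 hcon) hpow))
  let φ : Quotient s → K.isoTypes (succ lam) :=
    Quotient.lift (fun i => (⟨⟦N i⟧, N i, hN i, rfl⟩ : K.isoTypes (succ lam))) fun i j hij =>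
      Subtype.ext (Quotient.sound hij)
  have hφ : Function.Injective φ := by
    intro c d
    induction c using Quotient.inductionOn with
    | h i =>
      induction d using Quotient.inductionOn with
      | h j =>
        intro hij
        have h1 : (⟦N i⟧ : Quotient (FirstOrder.Language.equivSetoid :
          Setoid (Bundled.{u} L.Structure))) = ⟦N j⟧ := congrArg Subtype.val hij
        have h2 := Quotient.exact h1
        exact Quotient.sound (s := s) h2
  have := mk_le_of_injective (α := ULift.{u + 1} (Quotient s)) (f := fun c => φ c.down)
    fun c d hcd => ULift.ext _ _ (hφ hcd)
  rw [mk_uLift] at this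
  exact (lift_le.2 hQ).trans this

end AEC

/-- The subsets of an infinite set can be coded by pairwise incomparable subsets. -/
theorem exists_antichain {W : Type u} (hW : ℵ₀ ≤ #W) :
    ∃ code : Set W → Set W, ∀ X Y, code X ⊆ code Y → X = Y := by
  obtain ⟨e⟩ : Nonempty (W × Bool ≃ W) := Cardinal.eq.1 <| by
    rw [mk_prod, lift_uzero]
    exact mul_eq_left hW ((lift_le_aleph0.2 mk_le_aleph0).trans hW) (by simp)
  -- The code of `X` is the graph of its characteristic function; inclusion between graphs of total
  -- functions is equality.
  refine ⟨fun X => e '' {p | (p.1 ∈ X) ↔ p.2 = true}, fun X Y h => ?_⟩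
  have h' := (Set.image_subset_image_iff e.injective).1 h
  ext x
  refine ⟨fun hx => (h' (a := (x, true)) (by simpa using hx)).2 rfl, fun hy => ?_⟩
  by_contra hx
  have := (h' (a := (x, false)) (by simpa using hx)).1 hy
  simp at this

/-! ### Assembling the theorem -/

namespace AEC

open FirstOrder FirstOrder.Language Order CategoryTheory

variable {L : FirstOrder.Language.{u, u}} {K : AEC L} {lam : Cardinal.{u}}

/-- The extensions of `M` used in a tree: `none ↦ X`, `some false ↦ M₁`, `some true ↦ M₂`. -/
def threeExtensions (X M₁ M₂ : Bundled.{u} L.Structure) : Option Bool → Bundled.{u} L.Structure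
  | none => X
  | some false => M₁
  | some true => M₂

/-- A tree of models through three given extensions of a weakly limit model. -/
theorem exists_weaklyLimitTree_of_extensions {M : Type u} [L.Structure M] {S : Set (SuccOrd lam)}
    (hlam : ℵ₀ ≤ lam) (hM : K.MemCard lam M) (hlim : K.IsWeaklyLimit lam S M)
    {X M₁ M₂ : Bundled.{u} L.Structure} (hX : K.MemCard lam X) (hM₁ : K.MemCard lam M₁)
    (hM₂ : K.MemCard lam M₂) {gX : M ↪[L] X} {g₁ : M ↪[L] M₁} {g₂ : M ↪[L] M₂}
    (hgX : K.IsStrongEmb gX) (hg₁ : K.IsStrongEmb g₁) (hg₂ : K.IsStrongEmb g₂) :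
    ∃ g : ∀ b, M ↪[L] threeExtensions X M₁ M₂ b,
      g none = gX ∧ g (some false) = g₁ ∧ g (some true) = g₂ ∧
      (∀ b, K.MemCard lam (threeExtensions X M₁ M₂ b)) ∧
      Nonempty (WeaklyLimitTree K lam S M (fun b => threeExtensions X M₁ M₂ b) g) := by
  have hE : ∀ b, K.MemCard lam (threeExtensions X M₁ M₂ b) := by
    rintro (_ | _ | _)
    exacts [hX, hM₁, hM₂]
  let g : ∀ b, M ↪[L] threeExtensions X M₁ M₂ b := fun b =>
    match b with
    | none => gX
    | some false => g₁
    | some true => g₂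
  refine ⟨g, rfl, rfl, rfl, hE, exists_weaklyLimitTree hlam hM hlim hE ?_⟩
  rintro (_ | _ | _)
  exacts [hgX, hg₁, hg₂]

end AEC

open AEC FirstOrder.Language CategoryTheory in
theorem theorem3p5 {L : FirstOrder.Language.{u, u}} (K : AEC L) (lam : Cardinal.{u})
    (hLS : K.LS ≤ lam)
    (hpow : (2 : Cardinal.{u}) ^ lam < 2 ^ Order.succ lam)
    (S : Set (Order.succ lam).ord.ToType) (hS : S ∉ WDmId lam)
    (M : Type u) [L.Structure M] (hM : K.MemCard lam M)
    (hlim : K.IsWeaklyLimit lam S M)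
    (hAP : ¬ K.HasAP lam lam M) :
    #(K.isoTypes (Order.succ lam)) = Cardinal.lift.{u + 1} ((2 : Cardinal.{u}) ^ Order.succ lam) ∧
    (¬ ∃ (N : Type u) (_ : L.Structure N), K.IsUniversal (Order.succ lam) N) ∧
    (Order.succ ((2 : Cardinal.{u}) ^ lam) < 2 ^ Order.succ lam →
      ∃ (ι : Type u) (N : ι → CategoryTheory.Bundled.{u} L.Structure),
        #ι = 2 ^ Order.succ lam ∧
        (∀ i, K.MemCard (Order.succ lam) (N i)) ∧
        ∀ i j, i ≠ j → ¬ K.Embeds (N i) (N j)) := by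
  have hlam : ℵ₀ ≤ lam := K.LS_mem.1.trans hLS
  have hL : L.card ≤ lam := K.LS_mem.2.trans hLS
  have hκ : ℵ₀ ≤ (2 : Cardinal.{u}) ^ lam := hlam.trans (cantor lam).le
  obtain ⟨M₁, M₂, _, _, hM₁, hM₂, g₁, g₂, hg₁, hg₂, hna⟩ : ∃ (M₁ M₂ : Type u)
      (_ : L.Structure M₁) (_ : L.Structure M₂), K.MemCard lam M₁ ∧ K.MemCard lam M₂ ∧
      ∃ (g₁ : M ↪[L] M₁) (g₂ : M ↪[L] M₂), K.IsStrongEmb g₁ ∧ K.IsStrongEmb g₂ ∧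
      ¬ ∃ (N : Type u) (_ : L.Structure N) (f₁ : M₁ ↪[L] N) (f₂ : M₂ ↪[L] N),
        K.IsStrongEmb f₁ ∧ K.IsStrongEmb f₂ ∧ ∀ x, f₁ (g₁ x) = f₂ (g₂ x) := by
    by_contra hcon
    refine hAP fun M₁ M₂ _ _ hM₁ hM₂ g₁ g₂ hg₁ hg₂ => ?_
    by_contra hna
    exact hcon ⟨M₁, M₂, _, _, hM₁, hM₂, g₁, g₂, hg₁, hg₂, hna⟩
  have huniv : ¬ ∃ (N : Type u) (_ : L.Structure N), K.IsUniversal (Order.succ lam) N := by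
    rintro ⟨P, _, hP, hPuniv⟩
    -- The choice `none` plays no role for universality; its place is filled with `M₁`.
    obtain ⟨g, -, h₁, h₂, -, ⟨T⟩⟩ := exists_weaklyLimitTree_of_extensions (X := ⟨M₁, _⟩)
      (M₁ := ⟨M₁, _⟩) (M₂ := ⟨M₂, _⟩) hlam hM hlim hM₁ hM₁ hM₂ hg₁ hg₁ hg₂
    obtain ⟨f₀, f₁, hf₀, hf₁, h⟩ := T.exists_amalgam_of_universal hlam hS hP.2
      fun η => hPuniv _ (T.memCard η)
    rw [h₁, h₂] at h
    exact hna ⟨P, _, f₀, f₁, hf₀, hf₁, h⟩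
  by_cases hcase : ∃ (X : Type u) (_ : L.Structure X) (gX : M ↪[L] X), K.MemCard lam X ∧
      K.IsStrongEmb gX ∧ ∀ (D₁ D₂ : Type u) [L.Structure D₁] [L.Structure D₂], K.MemCard lam D₁ →
        K.MemCard lam D₂ → ∀ (j₁ : X ↪[L] D₁) (j₂ : X ↪[L] D₂),
        K.IsStrongEmb j₁ → K.IsStrongEmb j₂ →
        ∃ (P : Type u) (_ : L.Structure P) (h₁ : D₁ ↪[L] P) (h₂ : D₂ ↪[L] P),
          K.IsStrongEmb h₁ ∧ K.IsStrongEmb h₂ ∧ ∀ x, h₁ (j₁ (gX x)) = h₂ (j₂ (gX x))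
  · obtain ⟨X, _, gX, hX, hgX, hamal⟩ := hcase
    obtain ⟨g, hg, h₁, h₂, hE, ⟨T⟩⟩ := exists_weaklyLimitTree_of_extensions (X := ⟨X, _⟩)
      (M₁ := ⟨M₁, _⟩) (M₂ := ⟨M₂, _⟩) hlam hM hlim hX hM₁ hM₂ hgX hg₁ hg₂
    obtain ⟨η, hη⟩ := T.exists_family hlam hS hE (by rw [hg]; exact hamal)
      (by rw [h₁, h₂]; exact hna)
    obtain ⟨code, hcode⟩ := exists_antichain (W := SuccOrd lam)
      (by rw [SuccOrd.mk_eq]; exact hlam.trans (Order.le_succ lam))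
    have hinj : ∀ Y Z, K.Embeds (T.N (η (code Y))) (T.N (η (code Z))) → Y = Z := fun Y Z h =>
      hcode _ _ (hη _ _ h)
    have hι : #(Set (SuccOrd lam)) = 2 ^ Order.succ lam := by rw [mk_set, SuccOrd.mk_eq]
    refine ⟨le_antisymm (mk_isoTypes_le hlam hL) (le_mk_isoTypes hlam hpow hι _
      (fun Y => T.memCard (η (code Y))) fun Y => ?_), huniv, fun _ =>
      ⟨_, fun Y => T.N (η (code Y)), hι, fun Y => T.memCard _, fun Y Z hne h => hne (hinj Y Z h)⟩⟩
    refine le_trans ?_ (one_le_aleph0.trans hκ)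
    exact mk_le_one_iff_set_subsingleton.2 fun Z hZ Z' hZ' => (hinj _ _ hZ).trans (hinj _ _ hZ').symm
  · obtain ⟨N, k, hN, hk⟩ := exists_pairwise_not_amalgamable hlam hM hlim.2.2.1
      fun X _ gX hX hgX => by
        by_contra hcon
        refine hcase ⟨X, _, gX, hX, hgX, fun D₁ D₂ _ _ hD₁ hD₂ j₁ j₂ hj₁ hj₂ => ?_⟩
        by_contra hP
        let D : Bool → Bundled.{u} L.Structure := fun b =>
          match b with
          | false => ⟨D₁, inferInstance⟩
          | true => ⟨D₂, inferInstance⟩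
        let j : ∀ b, X ↪[L] D b := fun b =>
          match b with
          | false => j₁
          | true => j₂
        refine hcon ⟨D, j, ?_, ?_, hP⟩
        · rintro (_ | _)
          exacts [hD₁, hD₂]
        · rintro (_ | _)
          exacts [hj₁, hj₂]
    have hι : #(SuccOrd lam → Bool) = 2 ^ Order.succ lam := by
      rw [← SuccOrd.mk_eq (lam := lam)]
      simp
    have hfib : ∀ i, #{j | K.Embeds (N j) (N i)} ≤ 2 ^ lam := fun i =>
      mk_setOf_embeds_le hlam hM.2 hk (hN i).2
    refine ⟨le_antisymm (mk_isoTypes_le hlam hL) (le_mk_isoTypes hlam hpow hι N hN hfib), huniv,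
      fun hlt => ?_⟩
    -- The set mapping sends `i` to the indices of the models embeddable into `N i`; freeness is
    -- pairwise non-embeddability.
    obtain ⟨s, hs, hfree⟩ := exists_isFreeFor hκ hfib (by rwa [hι])
    exact ⟨s, fun i => N i, hs.trans hι, fun i => hN i, fun i j hij h =>
      hfree j j.2 i i.2 (fun h => hij (Subtype.ext h.symm)) h⟩
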